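/- **Setting.** Let $\Lambda$ be a finite set, $\mathcal K$ a separable complex Hilbert space, and $N_{\mathrm e}\ge 1$ an integer. Let $\mathcal H_{\mathrm e}=\bigotimes_{\mathrm{as}}^{N_{\mathrm e}}\ell^2(\Lambda;\mathbb C^2)$, let $c_{x,s}^{*},c_{x,s}$ ($x\in\Lambda$, $s=\pm$) be the electron creation and annihilation operators, $n_{x,s}=c_{x,s}^*c_{x,s}$ and $n_x=n_{x,+}+n_{x,-}$. Let $\mathcal F_{\mathrm b}=\bigoplus_{n\ge 0}\bigotimes_{\mathrm s}^n\mathcal K$ be the boson Fock space with vacuum $\Omega_{\mathrm b}$ and Segal field operators $\phi(f)=\frac1{\sqrt2}\,\overline{(a(f)+a(f)^*)}$. Let $T$ be a self-adjoint operator on $\ell^2(\Lambda;\mathbb C^2)$, $U>0$, $\alpha\in\mathbb R$ with $\alpha\neq0$, and let $\omega$ be a non-negative self-adjoint operator on $\mathcal K$ without eigenvalues. Let $(\lambda_x)_{x\in\Lambda}$ be vectors in $\operatorname{dom}\omega^{-1/2}$ such that $\langle\lambda_x,\lambda_y\rangle$ and $\langle\omega^{-1/2}\lambda_x,\omega^{-1/2}\lambda_y\rangle$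 are real for all $x,y$, and assume the infrared singular condition $$\sum_{(x,s)\in A}\lambda_x\notin\operatorname{dom}\omega^{-1}\qquad\text{for every } A\subset\Lambda\times\{+,-\}\text{ with } |A|=N_{\mathrm e}.$$ For every $\kappa>0$ let $(\lambda_x^\kappa)_{x\in\Lambda}$ be vectors in $\operatorname{dom}\omega^{-1/2}\cap\operatorname{dom}\omega^{-1}$ satisfying the same reality conditions and $\langle\omega^{-1/2}\lambda^\kappa_x,\omega^{-1/2}\lambda^\kappa_y\rangle=\delta_{x,y}(b^\kappa)^2$ with $b^\kappa\in\mathbb R$; assume $\lambda^\kappa_x\to\lambda_x$ and $\omega^{-1/2}\lambda^\kappa_x\to\omega^{-1/2}\lambda_x$ in norm as $\kappa\downarrow0$. For $\kappa>0$ let $\Psi^\kappa_{\mathrm{e,g}}\in\mathcal H_{\mathrm e}$ be an arbitrary normalized ground state of the Hubbard Hamiltonian $$\hat H^\kappa_{\mathrm e}=d\Gamma_{\mathrm e}(T)+\bigl(U-(\alpha b^\kappa)^2\bigr)\sum_{x\in\Lambda}n_{x,+}n_{x,-}$$ on $\mathcal H_{\mathrm e}$, let $S^\kappa$ be the self-adjoint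 closure of $\sum_{x\in\Lambda}n_x\otimes\phi(i\omega^{-1}\lambda^\kappa_x)$ on the algebraic tensor product of $\mathcal H_{\mathrm e}$ with the finite-particle vectors, and let $V^\kappa=e^{i\alpha S^\kappa}$ and $$\Psi^\kappa_{\mathrm g}=V^\kappa\bigl(\Psi^\kappa_{\mathrm{e,g}}\otimes\Omega_{\mathrm b}\bigr)\in\mathcal H_{\mathrm e}\otimes\mathcal F_{\mathrm b}.$$ **Theorem.** $\Psi^\kappa_{\mathrm g}$ converges weakly to $0$ as $\kappa\downarrow0$; that is, $\langle\Phi,\Psi^\kappa_{\mathrm g}\rangle\to0$ for every $\Phi\in\mathcal H_{\mathrm e}\otimes\mathcal F_{\mathrm b}$. -/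

import Mathlib

open Filter Topology
open scoped TensorProduct InnerProductSpace DirectSum

noncomputable section

namespace HubbardPhonon

universe u v

/-! ### Tensor powers of an inner product space -/

/-- An inner product space bundled with its structure (used only to iterate `K ⊗ ·`). -/
structure IPSpace : Type (u + 1) where
  carrier : Type u
  [grp : NormedAddCommGroup carrier]
  [ips : InnerProductSpace ℂ carrier]

attribute [instance] IPSpace.grp IPSpace.ips

variable (K : Type u) [NormedAddCommGroup K] [InnerProductSpace ℂ K]

/-- `K^{⊗0} = ℂ` (as the functions on a point) and `K^{⊗(n+1)} = K ⊗ K^{⊗n}`. -/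
def tensorPowBundle : ℕ → IPSpace.{u}
  | 0 => ⟨EuclideanSpace ℂ PUnit.{u + 1}⟩
  | n + 1 => ⟨K ⊗[ℂ] (tensorPowBundle n).carrier⟩

/-- The algebraic `n`-fold tensor power of `K`, with the usual inner product
`⟪f₁ ⊗ ⋯ ⊗ fₙ, g₁ ⊗ ⋯ ⊗ gₙ⟫ = ∏ ⟪fᵢ, gᵢ⟫`. -/
def TPow (n : ℕ) : Type u := (tensorPowBundle K n).carrier

instance (n : ℕ) : NormedAddCommGroup (TPow K n) := (tensorPowBundle K n).grp
instance (n : ℕ) : InnerProductSpace ℂ (TPow K n) := (tensorPowBundle K n).ips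

/-- The identification `K ⊗ K^{⊗n} = K^{⊗(n+1)}`. -/
def consTensor (n : ℕ) : K ⊗[ℂ] TPow K n ≃ₗᵢ[ℂ] TPow K (n + 1) :=
  LinearIsometryEquiv.refl ℂ (K ⊗[ℂ] TPow K n)

/-- The unit vector `1 ∈ ℂ = K^{⊗0}`. -/
def unitTensor : TPow K 0 := EuclideanSpace.single PUnit.unit (1 : ℂ)

variable {K}

/-- `f₀ ⊗ (f₁ ⊗ ⋯ ⊗ fₙ) ↦ ⟪g, f₀⟫ • f₁ ⊗ ⋯ ⊗ fₙ`. -/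
def contract (g : K) (n : ℕ) : TPow K (n + 1) →ₗ[ℂ] TPow K n :=
  (TensorProduct.lid ℂ (TPow K n)).toLinearMap ∘ₗ
    TensorProduct.map (innerₛₗ ℂ g) LinearMap.id ∘ₗ
      (consTensor K n).symm.toLinearEquiv.toLinearMap

/-- The sum over all positions of the insertion of `f`, with sign `ε` for each factor that `f`
passes: `f₁ ⊗ ⋯ ⊗ fₙ ↦ ∑ⱼ εʲ • f₁ ⊗ ⋯ ⊗ fⱼ ⊗ f ⊗ fⱼ₊₁ ⊗ ⋯ ⊗ fₙ`. -/
def insertion (ε : ℂ) (f : K) : (n : ℕ) → TPow K n →ₗ[ℂ] TPow K (n + 1)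
  | 0 => (consTensor K 0).toLinearEquiv.toLinearMap ∘ₗ TensorProduct.mk ℂ K (TPow K 0) f
  | n + 1 => (consTensor K (n + 1)).toLinearEquiv.toLinearMap ∘ₗ
      (TensorProduct.mk ℂ K (TPow K (n + 1)) f +
        ε • (TensorProduct.map LinearMap.id (insertion ε f n) ∘ₗ
          (consTensor K n).symm.toLinearEquiv.toLinearMap))

/-- For `ε = 1` the algebraic symmetric tensor power, for `ε = -1` the algebraic antisymmetric
one: the span of the tensors `∑_σ ε^{sgn σ} f_{σ 1} ⊗ ⋯ ⊗ f_{σ n}`, which are the iterated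
insertions of `f₁, …, fₙ`. -/
def sector (ε : ℂ) : (n : ℕ) → Submodule ℂ (TPow K n)
  | 0 => ⊤
  | n + 1 => Submodule.span ℂ {y | ∃ f : K, ∃ x ∈ sector ε n, y = insertion ε f n x}

theorem contract_consTensor (g f : K) (n : ℕ) (x : TPow K n) :
    contract g n (consTensor K n (f ⊗ₜ[ℂ] x)) = ⟪g, f⟫_ℂ • x := by
  simp [contract]

theorem insertion_consTensor (ε : ℂ) (f h : K) (n : ℕ) (x : TPow K n) :
    insertion ε f (n + 1) (consTensor K n (h ⊗ₜ[ℂ] x)) =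
      consTensor K (n + 1) (f ⊗ₜ[ℂ] consTensor K n (h ⊗ₜ[ℂ] x)) +
        ε • consTensor K (n + 1) (h ⊗ₜ[ℂ] insertion ε f n x) := by
  simp [insertion]

/-- The canonical (anti)commutation relation between contraction and insertion. -/
theorem contract_insertion_succ (ε : ℂ) (g f : K) (n : ℕ) (x : TPow K (n + 1)) :
    contract g (n + 1) (insertion ε f (n + 1) x) =
      ⟪g, f⟫_ℂ • x + ε • insertion ε f n (contract g n x) := by
  obtain ⟨y, rfl⟩ := (consTensor K n).surjective x
  induction y using TensorProduct.induction_on with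
  | zero => simp
  | tmul h z =>
    rw [insertion_consTensor, map_add, map_smul, contract_consTensor, contract_consTensor,
      contract_consTensor, map_smul]
  | add a b ha hb =>
    simp only [map_add, ha, hb, smul_add]
    abel

theorem contract_insertion_zero (ε : ℂ) (g f : K) (x : TPow K 0) :
    contract g 0 (insertion ε f 0 x) = ⟪g, f⟫_ℂ • x :=
  contract_consTensor g f 0 x

theorem insertion_mem (ε : ℂ) (f : K) (n : ℕ) (x : TPow K n) (hx : x ∈ sector ε n) :
    insertion ε f n x ∈ sector (K := K) ε (n + 1) :=
  Submodule.subset_span ⟨f, x, hx, rfl⟩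

theorem contract_mem (ε : ℂ) (g : K) :
    ∀ (n : ℕ) (x : TPow K (n + 1)), x ∈ sector ε (n + 1) →
      contract g n x ∈ sector (K := K) ε n := by
  intro n
  induction n with
  | zero => intro x _; exact Submodule.mem_top
  | succ n ih =>
    intro x hx
    refine Submodule.span_induction ?_ ?_ ?_ ?_ hx
    · rintro _ ⟨f, y, hy, rfl⟩
      rw [contract_insertion_succ]
      exact Submodule.add_mem _ (Submodule.smul_mem _ _ hy)
        (Submodule.smul_mem _ _ (insertion_mem ε f n _ (ih y hy)))
    · rw [map_zero]; exact Submodule.zero_mem _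
    · intro a b _ _ ha hb; rw [map_add]; exact Submodule.add_mem _ ha hb
    · intro c a _ ha; rw [map_smul]; exact Submodule.smul_mem _ _ ha

/-- Insertion on the (anti)symmetric tensors; it is `√(n+1)` times the creation operator. -/
def sectorInsert (ε : ℂ) (f : K) (n : ℕ) :
    sector (K := K) ε n →ₗ[ℂ] sector (K := K) ε (n + 1) :=
  (insertion ε f n).restrict (insertion_mem ε f n)

/-- Contraction on the (anti)symmetric tensors; `√(n+1)` times it is the annihilation operator. -/
def sectorContract (ε : ℂ) (g : K) (n : ℕ) :
    sector (K := K) ε (n + 1) →ₗ[ℂ] sector (K := K) ε n :=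
  (contract g n).restrict (contract_mem ε g n)

/-- The creation operator `f ↦ a*(f)` (or `c*(f)`) from the `n`- to the `(n+1)`-particle space. -/
def create (ε : ℂ) (f : K) (n : ℕ) : sector (K := K) ε n →ₗ[ℂ] sector (K := K) ε (n + 1) :=
  ((Real.sqrt (n + 1) : ℂ)⁻¹) • sectorInsert ε f n

/-- The annihilation operator `a(f)` (or `c(f)`) from the `(n+1)`- to the `n`-particle space. -/
def annihilate (ε : ℂ) (f : K) (n : ℕ) :
    sector (K := K) ε (n + 1) →ₗ[ℂ] sector (K := K) ε n :=
  (Real.sqrt (n + 1) : ℂ) • sectorContract ε f n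

/-! ### Bosons -/

variable (K)

theorem unitTensor_mem (ε : ℂ) : unitTensor K ∈ sector (K := K) ε 0 := Submodule.mem_top

/-- The finite particle space: the algebraic direct sum of the algebraic symmetric tensor powers. -/
abbrev BosonFin : Type u := ⨁ n : ℕ, sector (K := K) (1 : ℂ) n

/-- The boson Fock space: the Hilbert direct sum of the completed symmetric tensor powers. -/
abbrev BosonFock : Type u :=
  lp (fun n : ℕ => UniformSpace.Completion (sector (K := K) (1 : ℂ) n)) 2

/-- The inclusion of the finite particle space in the Fock space. -/
def bosonEmbed : BosonFin K →ₗ[ℂ] BosonFock K :=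
  DirectSum.toModule ℂ ℕ (BosonFock K) fun n =>
    lp.lsingle (𝕜 := ℂ) 2 n ∘ₗ
      (UniformSpace.Completion.toComplₗᵢ (𝕜 := ℂ) (E := sector (K := K) (1 : ℂ) n)).toLinearMap

/-- The Fock vacuum. -/
def vacuum : BosonFock K :=
  bosonEmbed K (DirectSum.lof ℂ ℕ (fun n => sector (K := K) (1 : ℂ) n) 0
    ⟨unitTensor K, unitTensor_mem K 1⟩)

variable {K}

/-- `a*(f)` on the finite particle space. -/
def bosonCreate (f : K) : BosonFin K →ₗ[ℂ] BosonFin K :=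
  DirectSum.toModule ℂ ℕ _ fun n =>
    DirectSum.lof ℂ ℕ (fun n => sector (K := K) (1 : ℂ) n) (n + 1) ∘ₗ create 1 f n

/-- `a(f)` on the finite particle space. -/
def bosonAnnihilate (f : K) : BosonFin K →ₗ[ℂ] BosonFin K :=
  DirectSum.toModule ℂ ℕ _ fun n => match n with
    | 0 => 0
    | n + 1 => DirectSum.lof ℂ ℕ (fun n => sector (K := K) (1 : ℂ) n) n ∘ₗ annihilate 1 f n

/-- Segal's field operator `φ(f) = (a(f) + a*(f)) / √2` on the finite particle space. -/
def segalField (f : K) : BosonFin K →ₗ[ℂ] BosonFin K :=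
  ((Real.sqrt 2 : ℂ)⁻¹) • (bosonAnnihilate f + bosonCreate f)

/-! ### Electrons -/

variable (Λ : Type v) [Fintype Λ]

/-- The one-electron space `ℓ²(Λ; ℂ²)`; the spin `+` is `0`, the spin `-` is `1`. -/
abbrev OneElectron : Type v := EuclideanSpace ℂ (Λ × Fin 2)

/-- The `N`-electron space `⊗_as^N ℓ²(Λ; ℂ²)`. -/
abbrev Electrons (N : ℕ) : Type v := sector (K := OneElectron Λ) (-1 : ℂ) N

variable {Λ}

/-- `c*(f) c(g)` on the `N`-electron space. -/
def electronHop (f g : OneElectron Λ) : (N : ℕ) → Module.End ℂ (Electrons Λ N)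
  | 0 => 0
  | N + 1 => create (-1) f N ∘ₗ annihilate (-1) g N

variable [DecidableEq Λ]

/-- The state of one electron in the orbital `p = (x, s)`. -/
def orbital (p : Λ × Fin 2) : OneElectron Λ := EuclideanSpace.single p (1 : ℂ)

/-- `n_{x,s} = c*_{x,s} c_{x,s}`. -/
def occupation (N : ℕ) (p : Λ × Fin 2) : Module.End ℂ (Electrons Λ N) :=
  electronHop (orbital p) (orbital p) N

/-- `n_x = n_{x,+} + n_{x,-}`. -/
def siteOccupation (N : ℕ) (x : Λ) : Module.End ℂ (Electrons Λ N) :=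
  occupation N (x, 0) + occupation N (x, 1)

/-- The Hubbard Hamiltonian `dΓ(T) + U ∑_x n_{x,+} n_{x,-}` on the `N`-electron space, with
`dΓ(T) = ∑_{p,q} t_{p,q} c*_p c_q`. -/
def hubbard (N : ℕ) (T : Matrix (Λ × Fin 2) (Λ × Fin 2) ℂ) (U : ℝ) :
    Module.End ℂ (Electrons Λ N) :=
  (∑ p, ∑ q, T p q • electronHop (orbital p) (orbital q) N) +
    (U : ℂ) • ∑ x : Λ, occupation N (x, 0) * occupation N (x, 1)

/-- `ψ` is a normalized ground state of `A`: a unit eigenvector for `E₀ = inf σ(A)`. -/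
def IsGroundState {N : ℕ} (A : Module.End ℂ (Electrons Λ N)) (ψ : Electrons Λ N) : Prop :=
  ‖ψ‖ = 1 ∧ ∃ E : ℝ, IsLeast {e : ℝ | (e : ℂ) ∈ spectrum ℂ A} E ∧ A ψ = (E : ℂ) • ψ

/-! ### Unbounded operators -/

section Operators

variable {E : Type*} [NormedAddCommGroup E] [InnerProductSpace ℂ E]

/-- `A v`, with the value `0` when `v` is not in the domain of `A`. -/
def pmapApply (A : E →ₗ.[ℂ] E) (v : E) : E :=
  open Classical in if h : v ∈ A.domain then A ⟨v, h⟩ else 0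

/-- A non-negative self-adjoint operator. -/
def IsNonnegSelfAdjoint [CompleteSpace E] (A : E →ₗ.[ℂ] E) : Prop :=
  IsSelfAdjoint A ∧ ∀ v : A.domain, 0 ≤ (⟪(v : E), A v⟫_ℂ).re

/-- `A` has no eigenvalues. -/
def HasNoEigenvalue (A : E →ₗ.[ℂ] E) : Prop :=
  ∀ (c : ℂ) (v : A.domain), A v = c • (v : E) → (v : E) = 0

/-- `R` is the non-negative self-adjoint square root of `A`: `R ∘ R = A`, domains included. -/
def IsOperatorSqrt [CompleteSpace E] (R A : E →ₗ.[ℂ] E) : Prop :=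
  IsNonnegSelfAdjoint R ∧
    ∀ v w : E, (v, w) ∈ A.graph ↔ ∃ z : E, (v, z) ∈ R.graph ∧ (z, w) ∈ R.graph

/-- `A^{1/2}` for a non-negative self-adjoint `A`, for which it exists and is unique. -/
def operatorSqrt [CompleteSpace E] (A : E →ₗ.[ℂ] E) : E →ₗ.[ℂ] E :=
  open Classical in if h : ∃ R, IsOperatorSqrt R A then h.choose else 0

/-- `U` is the strongly continuous one-parameter unitary group `t ↦ e^{itA}`, where the operator
`A` is given by its graph: `A` is exactly the (self-adjoint) infinitesimal generator of `U`. -/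
structure IsUnitaryGroup (A : Submodule ℂ (E × E)) (U : ℝ → E ≃ₗᵢ[ℂ] E) : Prop where
  add : ∀ (s t : ℝ) (ψ : E), U (s + t) ψ = U s (U t ψ)
  continuous : ∀ ψ : E, Continuous fun t => U t ψ
  generator : ∀ ψ η : E,
    (ψ, η) ∈ A ↔ HasDerivAt (fun t => U t ψ) (Complex.I • η) 0

/-- `e^{itA}` for the operator with graph `A`. By Stone's theorem the group exists and is unique
when `A` is self-adjoint; the value `1` is taken if there is none. -/
def expI (A : Submodule ℂ (E × E)) (t : ℝ) : E ≃ₗᵢ[ℂ] E :=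
  open Classical in
    if h : ∃ U : ℝ → E ≃ₗᵢ[ℂ] E, IsUnitaryGroup A U then h.choose t else
      LinearIsometryEquiv.refl ℂ E

end Operators

/-! ### The electron-phonon system -/

/-- The tensor product of inner product spaces, with Mathlib's inner product. -/
abbrev InnerTensor (E : Type u) (F : Type v) [NormedAddCommGroup E] [InnerProductSpace ℂ E]
    [NormedAddCommGroup F] [InnerProductSpace ℂ F] : Type (max u v) := E ⊗[ℂ] F

variable (Λ K) in
/-- The Hilbert space `⊗_as^N ℓ²(Λ; ℂ²) ⊗ ℱ_b`; the first factor is finite-dimensional, so no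
completion is needed. -/
abbrev System (N : ℕ) : Type (max v u) := InnerTensor (Electrons Λ N) (BosonFock K)

/-- The inclusion of the algebraic tensor product of the electron space with the finite particle
space. -/
def systemEmbed (N : ℕ) : Electrons Λ N ⊗[ℂ] BosonFin K →ₗ[ℂ] System K Λ N :=
  TensorProduct.map LinearMap.id (bosonEmbed K)

/-- `∑_x n_x ⊗ φ(g_x)` on the algebraic tensor product of the electron space with the finite
particle space. -/
def couplingFin (N : ℕ) (g : Λ → K) :
    Electrons Λ N ⊗[ℂ] BosonFin K →ₗ[ℂ] Electrons Λ N ⊗[ℂ] BosonFin K :=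
  ∑ x, TensorProduct.map (siteOccupation N x) (segalField (g x))

/-- The graph of the closure of `∑_x n_x ⊗ φ(g_x)`, which is self-adjoint. -/
def coupling (N : ℕ) (g : Λ → K) : Submodule ℂ (System K Λ N × System K Λ N) :=
  (LinearMap.range
    ((systemEmbed (K := K) (Λ := Λ) N).prod (systemEmbed N ∘ₗ couplingFin N g))).topologicalClosure

/-- `V = e^{iαS}` with `S = ∑_x n_x ⊗ φ(i ω⁻¹ l_x)`, for a family `l_x ∈ dom ω⁻¹`. -/
def dressing (N : ℕ) (ω : K →ₗ.[ℂ] K) (α : ℝ) (l : Λ → K) :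
    System K Λ N ≃ₗᵢ[ℂ] System K Λ N :=
  expI (coupling N fun x => Complex.I • pmapApply ω.inverse (l x)) α

/-- `ω^{-1/2}`. -/
def invSqrt [CompleteSpace K] (ω : K →ₗ.[ℂ] K) : K →ₗ.[ℂ] K := (operatorSqrt ω).inverse

/-- The vectors `l_x` lie in `dom ω^{-1/2}` and are real:
`⟪l_x, l_y⟫` and `⟪ω^{-1/2} l_x, ω^{-1/2} l_y⟫` are real numbers. -/
def IsRealCoupling [CompleteSpace K] (ω : K →ₗ.[ℂ] K) (l : Λ → K) : Prop :=
  (∀ x, l x ∈ (invSqrt ω).domain) ∧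
  (∀ x y, (⟪l x, l y⟫_ℂ).im = 0) ∧
  ∀ x y, (⟪pmapApply (invSqrt ω) (l x), pmapApply (invSqrt ω) (l y)⟫_ℂ).im = 0

end HubbardPhonon

end

/-! Occupation numbers diagonalise the coupling. If `u` is an electron state in which exactly the
orbitals of `A` are occupied, then `S` acts on `u ⊗ ψ` as the single field `φ(f)` with `f = i
∑_{(x,s) ∈ A} ω⁻¹ λ_x^κ` (`couplingFin_tmul_of_isOccupied`), so the dressed vector is `u` tensored
with the coherent state `e^{iαφ(f)} Ω`. Its matrix element with a fixed `n`-boson vector is at most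
a constant times `(|α| ‖f‖)ⁿ exp(-(α‖f‖)²/4)` (`exists_norm_coherentCoeff_le`), hence it vanishes in
the limit as soon as `‖f‖ → ∞`. This divergence is the infrared singularity: were `‖ω⁻¹ v_κ‖`
bounded along some `κ → 0` while `v_κ → v`, self-adjointness of `ω` would put `v` in the range of
`ω`, that is, in `dom ω⁻¹` (`tendsto_norm_inverse_atTop`). States with sharp occupation numbers span
the finite-dimensional electron space (`span_isOccupied`), so the limit holds for each fixed
electron vector and then for the bounded family of ground states (`tendsto_apply_zero_of_bounded`).
What remains is to identify `expI`, defined through the generator, with the exponential series.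
Finite-particle vectors are entire for `S`, so the series defines a unitary group generated by
exactly the closure of `S`, and such a group is unique (`expI_closedGraph`). -/

noncomputable section

namespace HubbardPhonon

universe u v

/-! ### Entire vectors and the generated unitary group -/

section EntireVectors

variable {D H : Type*} [AddCommGroup D] [Module ℂ D] [NormedAddCommGroup H]
  [InnerProductSpace ℂ H]

/-- `ψ` is an entire vector of `S`: `∑ₙ rⁿ ‖Sⁿψ‖ / n!` converges for all `r`. -/
def IsEntireVector (j : D →ₗ[ℂ] H) (S : Module.End ℂ D) (ψ : D) : Prop :=
  ∀ r : ℝ, 0 ≤ r → Summable fun n : ℕ => r ^ n / n.factorial * ‖j ((S ^ n) ψ)‖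

theorem isEntireVector_zero (j : D →ₗ[ℂ] H) (S : Module.End ℂ D) : IsEntireVector j S 0 := by
  intro r _
  simp

theorem IsEntireVector.add {j : D →ₗ[ℂ] H} {S : Module.End ℂ D} {ψ φ : D}
    (hψ : IsEntireVector j S ψ) (hφ : IsEntireVector j S φ) : IsEntireVector j S (ψ + φ) := by
  intro r hr
  refine Summable.of_nonneg_of_le (fun n => by positivity) (fun n => ?_)
    ((hψ r hr).add (hφ r hr))
  rw [map_add, map_add, ← mul_add]
  gcongr
  exact norm_add_le _ _

theorem IsEntireVector.smul {j : D →ₗ[ℂ] H} {S : Module.End ℂ D} {ψ : D}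
    (hψ : IsEntireVector j S ψ) (c : ℂ) : IsEntireVector j S (c • ψ) := by
  intro r hr
  refine ((hψ r hr).mul_left ‖c‖).congr fun n => ?_
  rw [map_smul, map_smul, norm_smul]
  ring

theorem IsEntireVector.apply {j : D →ₗ[ℂ] H} {S : Module.End ℂ D} {ψ : D}
    (hψ : IsEntireVector j S ψ) : IsEntireVector j S (S ψ) := by
  intro r hr
  have h := (summable_nat_add_iff 1).2 (hψ (r + 1) (by positivity))
  refine Summable.of_nonneg_of_le (fun n => by positivity) (fun n => ?_) h
  rw [← Module.End.mul_apply, ← pow_succ]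
  refine mul_le_mul_of_nonneg_right ?_ (norm_nonneg _)
  rw [div_le_div_iff₀ (by positivity) (by positivity), Nat.factorial_succ]
  -- The left side is a single term of the binomial expansion of the right side.
  have h1 : r ^ n * (n + 1) ≤ (r + 1) ^ (n + 1) := by
    rw [add_pow]
    refine le_trans (le_of_eq ?_) (Finset.single_le_sum (a := n)
      (f := fun m => r ^ m * 1 ^ (n + 1 - m) * ((n + 1).choose m : ℝ))
      (fun i _ => by positivity) (Finset.mem_range.2 (by omega)))
    simp
  push_cast
  calc r ^ n * ((n + 1) * (n.factorial : ℝ)) = (r ^ n * (n + 1)) * n.factorial := by ring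
    _ ≤ _ := mul_le_mul_of_nonneg_right h1 (by positivity)

/-- `∑ₙ (it)ⁿ / n! Sⁿ ψ`. -/
def expSeries (j : D →ₗ[ℂ] H) (S : Module.End ℂ D) (t : ℝ) (ψ : D) : H :=
  ∑' n : ℕ, ((Complex.I * t) ^ n / (n.factorial : ℂ)) • j ((S ^ n) ψ)

theorem norm_expSeries_term (j : D →ₗ[ℂ] H) (S : Module.End ℂ D) (t : ℝ) (ψ : D) (n : ℕ) :
    ‖((Complex.I * t) ^ n / (n.factorial : ℂ)) • j ((S ^ n) ψ)‖ =
      |t| ^ n / n.factorial * ‖j ((S ^ n) ψ)‖ := by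
  rw [norm_smul, norm_div, norm_pow, norm_mul, Complex.norm_I, one_mul, Complex.norm_real,
    Complex.norm_natCast, Real.norm_eq_abs]

theorem expSeries_zero (j : D →ₗ[ℂ] H) (S : Module.End ℂ D) (ψ : D) :
    expSeries j S 0 ψ = j ψ := by
  rw [expSeries, tsum_eq_single 0]
  · simp
  · intro n hn
    simp [hn]

variable [CompleteSpace H]

theorem IsEntireVector.hasSum {j : D →ₗ[ℂ] H} {S : Module.End ℂ D} {ψ : D}
    (hψ : IsEntireVector j S ψ) (t : ℝ) :
    HasSum (fun n : ℕ => ((Complex.I * t) ^ n / (n.factorial : ℂ)) • j ((S ^ n) ψ))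
      (expSeries j S t ψ) :=
  (Summable.of_norm ((hψ |t| (abs_nonneg t)).congr
    fun n => (norm_expSeries_term j S t ψ n).symm)).hasSum

/-- The termwise derivative of `expSeries`. -/
def expSeriesDeriv (j : D →ₗ[ℂ] H) (S : Module.End ℂ D) (ψ : D) (n : ℕ) (y : ℝ) : H :=
  ((Complex.I * (n * (Complex.I * y) ^ (n - 1))) / (n.factorial : ℂ)) • j ((S ^ n) ψ)

omit [CompleteSpace H] in
theorem expSeriesDeriv_succ (j : D →ₗ[ℂ] H) (S : Module.End ℂ D) (ψ : D) (n : ℕ) (y : ℝ) :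
    expSeriesDeriv j S ψ (n + 1) y = Complex.I •
      ((Complex.I * y) ^ n / (n.factorial : ℂ)) • j ((S ^ n) (S ψ)) := by
  have : (n.factorial : ℂ) ≠ 0 := by exact_mod_cast n.factorial_ne_zero
  have : (n : ℂ) + 1 ≠ 0 := by exact_mod_cast n.succ_ne_zero
  rw [expSeriesDeriv, smul_smul, Nat.add_sub_cancel, Nat.factorial_succ,
    pow_succ S, Module.End.mul_apply]
  congr 1
  push_cast
  field_simp

/-- Termwise differentiation on the ball of radius `|t| + 1`. Differentiating shifts the index by
one, so the majorant is the convergent series of `S ψ` at that radius. -/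
theorem IsEntireVector.hasDerivAt {j : D →ₗ[ℂ] H} {S : Module.End ℂ D} {ψ : D}
    (hψ : IsEntireVector j S ψ) (t : ℝ) :
    HasDerivAt (fun t => expSeries j S t ψ) (Complex.I • expSeries j S t (S ψ)) t := by
  have hR : 0 ≤ |t| + 1 := by positivity
  have h0 := hψ.hasSum 0
  have hd := (hψ.apply.hasSum t).const_smul Complex.I
  have hu' := hψ.apply _ hR
  generalize expSeries j S t (S ψ) = L at hd ⊢
  have hterm : ∀ n (y : ℝ), HasDerivAt
      (fun y : ℝ => ((Complex.I * y) ^ n / (n.factorial : ℂ)) • j ((S ^ n) ψ))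
      (expSeriesDeriv j S ψ n y) y := by
    intro n y
    have h1 : HasDerivAt (fun y : ℝ => Complex.I * (y : ℂ)) Complex.I y := by
      simpa using (Complex.ofRealCLM.hasDerivAt (x := y)).const_mul Complex.I
    have h2 := ((h1.pow n).div_const (n.factorial : ℂ)).smul_const (j ((S ^ n) ψ))
    refine h2.congr_deriv ?_
    rw [expSeriesDeriv]
    congr 2
    ring
  have hu : Summable fun n : ℕ => if n = 0 then (0 : ℝ) else
      (|t| + 1) ^ (n - 1) / (n - 1).factorial * ‖j ((S ^ (n - 1)) (S ψ))‖ := by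
    rw [← summable_nat_add_iff 1]
    simpa using hu'
  have hle : ∀ n (y : ℝ), y ∈ Metric.ball (0 : ℝ) (|t| + 1) → ‖expSeriesDeriv j S ψ n y‖ ≤
      if n = 0 then (0 : ℝ) else
      (|t| + 1) ^ (n - 1) / (n - 1).factorial * ‖j ((S ^ (n - 1)) (S ψ))‖ := by
    intro n y hy
    rcases n with _ | n
    · simp [expSeriesDeriv]
    · rw [expSeriesDeriv_succ, norm_smul, Complex.norm_I, one_mul, norm_expSeries_term]
      simp only [Nat.add_sub_cancel, Nat.succ_ne_zero, if_false]
      have : |y| ≤ |t| + 1 := by simpa using (mem_ball_zero_iff.1 hy).le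
      refine mul_le_mul_of_nonneg_right ?_ (norm_nonneg _)
      gcongr
  have key := hasDerivAt_tsum_of_isPreconnected (𝕜 := ℝ) hu Metric.isOpen_ball
    (convex_ball _ _).isPreconnected (fun n y _ => hterm n y) hle
    (Metric.mem_ball_self (by positivity)) h0.summable (y := t) (by simp)
  have h2 : HasSum (fun n => expSeriesDeriv j S ψ n t) (Complex.I • L) := by
    rw [← hasSum_nat_add_iff' 1]
    simp only [expSeriesDeriv_succ]
    simpa [expSeriesDeriv] using hd
  rw [h2.tsum_eq] at key
  exact key

variable (j : D →ₗ[ℂ] H) (S : Module.End ℂ D)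

/-- The closure of the graph of `S`. -/
def closedGraph : Submodule ℂ (H × H) :=
  (LinearMap.range (j.prod (j ∘ₗ S))).topologicalClosure

variable {j S}

omit [CompleteSpace H] in
theorem mem_closedGraph (ψ : D) : (j ψ, j (S ψ)) ∈ closedGraph j S :=
  Submodule.le_topologicalClosure _ ⟨ψ, rfl⟩

omit [CompleteSpace H] in
theorem closedGraph_induction {p : H → H → Prop} (hp : IsClosed {x : H × H | p x.1 x.2})
    (h : ∀ ψ, p (j ψ) (j (S ψ))) {x y : H} (hxy : (x, y) ∈ closedGraph j S) : p x y := by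
  have : (closedGraph j S : Set (H × H)) ⊆ {x : H × H | p x.1 x.2} := by
    rw [closedGraph, Submodule.topologicalClosure_coe]
    refine closure_minimal ?_ hp
    rintro _ ⟨ψ, rfl⟩
    exact h ψ
  exact this hxy

omit [CompleteSpace H] in
theorem inner_closedGraph (hS : ∀ ψ φ, ⟪j (S ψ), j φ⟫_ℂ = ⟪j ψ, j (S φ)⟫_ℂ)
    {x y x' y' : H} (h : (x, y) ∈ closedGraph j S) (h' : (x', y') ∈ closedGraph j S) :
    ⟪y, x'⟫_ℂ = ⟪x, y'⟫_ℂ := by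
  refine closedGraph_induction (p := fun x y => ⟪y, x'⟫_ℂ = ⟪x, y'⟫_ℂ)
    (isClosed_eq (by fun_prop) (by fun_prop)) (fun ψ => ?_) h
  exact closedGraph_induction (p := fun x' y' => ⟪j (S ψ), x'⟫_ℂ = ⟪j ψ, y'⟫_ℂ)
    (isClosed_eq (by fun_prop) (by fun_prop)) (fun φ => hS ψ φ) h'

/-- `S` commutes with its powers, so the partial sums of the two series pair up to points of the
graph of `S`; the limit lies in the closure. -/
theorem IsEntireVector.expSeries_mem {ψ : D} (hψ : IsEntireVector j S ψ) (t : ℝ) :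
    (expSeries j S t ψ, expSeries j S t (S ψ)) ∈ closedGraph j S := by
  have h := ((hψ.hasSum t).prodMk (hψ.apply.hasSum t)).tendsto_sum_nat
  refine (Submodule.isClosed_topologicalClosure _).mem_of_tendsto h (Eventually.of_forall ?_)
  intro N
  refine Submodule.sum_mem _ fun n _ => ?_
  have := Submodule.smul_mem _ ((Complex.I * t) ^ n / (n.factorial : ℂ))
    (mem_closedGraph (j := j) (S := S) ((S ^ n) ψ))
  rw [← Module.End.mul_apply, ← pow_succ', pow_succ, Module.End.mul_apply] at this
  exact this

/-- Lowering both times by `r` does not change the inner product: its derivative in `r` vanishes by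
symmetry of `S`. Compare `r = 0` with `r = s`. -/
theorem inner_expSeries_expSeries (hS : ∀ ψ φ, ⟪j (S ψ), j φ⟫_ℂ = ⟪j ψ, j (S φ)⟫_ℂ)
    (hE : ∀ ψ, IsEntireVector j S ψ) (ψ φ : D) (s t : ℝ) :
    ⟪expSeries j S s ψ, expSeries j S t φ⟫_ℂ = ⟪j ψ, expSeries j S (t - s) φ⟫_ℂ := by
  let f : ℝ → ℂ := fun r => ⟪expSeries j S (s - r) ψ, expSeries j S (t - r) φ⟫_ℂ
  have hf : ∀ r, HasDerivAt f 0 r := by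
    intro r
    have h1 := ((hE ψ).hasDerivAt (s - r)).scomp r ((hasDerivAt_id r).const_sub s)
    have h2 := ((hE φ).hasDerivAt (t - r)).scomp r ((hasDerivAt_id r).const_sub t)
    have h3 := h1.inner ℂ h2
    refine HasDerivAt.congr_deriv (f := f) h3 ?_
    have := inner_closedGraph hS ((hE ψ).expSeries_mem (s - r)) ((hE φ).expSeries_mem (t - r))
    simp [inner_smul_left, inner_smul_right, this]
  have h := is_const_of_deriv_eq_zero (fun r => (hf r).differentiableAt)
    (fun r => (hf r).deriv) 0 s
  simpa [f, expSeries_zero] using h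

theorem norm_expSeries (hS : ∀ ψ φ, ⟪j (S ψ), j φ⟫_ℂ = ⟪j ψ, j (S φ)⟫_ℂ)
    (hE : ∀ ψ, IsEntireVector j S ψ) (t : ℝ) (ψ : D) : ‖expSeries j S t ψ‖ = ‖j ψ‖ := by
  have := inner_expSeries_expSeries hS hE ψ ψ t t
  rw [sub_self, expSeries_zero, inner_self_eq_norm_sq_to_K, inner_self_eq_norm_sq_to_K] at this
  have h : ‖expSeries j S t ψ‖ ^ 2 = ‖j ψ‖ ^ 2 := by exact_mod_cast this
  exact (sq_eq_sq₀ (norm_nonneg _) (norm_nonneg _)).1 h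

/-- `ψ ↦ ∑ₙ (it)ⁿ / n! Sⁿ ψ` as a linear map. -/
def expSeriesₗ (hE : ∀ ψ, IsEntireVector j S ψ) (t : ℝ) : D →ₗ[ℂ] H where
  toFun := expSeries j S t
  map_add' ψ φ := by
    refine (HasSum.unique ?_ ((hE (ψ + φ)).hasSum t)).symm
    simpa using ((hE ψ).hasSum t).add ((hE φ).hasSum t)
  map_smul' c ψ := by
    refine (HasSum.unique ?_ ((hE (c • ψ)).hasSum t)).symm
    simpa [smul_comm c] using ((hE ψ).hasSum t).const_smul c

/-- The bounded extension of `ψ ↦ ∑ₙ (it)ⁿ / n! Sⁿ ψ`. -/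
def expL (hE : ∀ ψ, IsEntireVector j S ψ) (t : ℝ) : H →L[ℂ] H :=
  (expSeriesₗ hE t).extendOfNorm j

variable (hj : DenseRange j) (hS : ∀ ψ φ, ⟪j (S ψ), j φ⟫_ℂ = ⟪j ψ, j (S φ)⟫_ℂ)
  (hE : ∀ ψ, IsEntireVector j S ψ)
include hj hS

theorem expL_apply (t : ℝ) (ψ : D) : expL hE t (j ψ) = expSeries j S t ψ :=
  LinearMap.extendOfNorm_eq hj ⟨1, fun x => by
    rw [one_mul]; exact (norm_expSeries hS hE t x).le⟩ ψ

theorem norm_expL (t : ℝ) (x : H) : ‖expL hE t x‖ = ‖x‖ :=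
  hj.induction_on (p := fun x => ‖expL hE t x‖ = ‖x‖) x
    (isClosed_eq (by fun_prop) (by fun_prop)) fun ψ => by
      rw [expL_apply hj hS, norm_expSeries hS hE]

/-- The vector `expSeries j S t φ` need not lie in the range of `j`, so `expL_apply` is not
available. Instead, both sides have norm `‖j φ‖` and their inner product is `‖j φ‖²`, so their
difference has norm zero. -/
theorem expL_expSeries (s t : ℝ) (φ : D) :
    expL hE s (expSeries j S t φ) = expSeries j S (s + t) φ := by
  have h : ∀ x, ⟪expL hE s x, expSeries j S (s + t) φ⟫_ℂ = ⟪x, expSeries j S t φ⟫_ℂ := fun x =>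
    hj.induction_on (p := fun x => ⟪expL hE s x, expSeries j S (s + t) φ⟫_ℂ =
      ⟪x, expSeries j S t φ⟫_ℂ) x (isClosed_eq (by fun_prop) (by fun_prop)) fun ψ => by
      rw [expL_apply hj hS, inner_expSeries_expSeries hS hE]
      simp
  rw [← sub_eq_zero, ← norm_eq_zero, ← sq_eq_zero_iff, @norm_sub_sq ℂ, h, norm_expL hj hS,
    norm_expSeries hS hE, norm_expSeries hS hE, inner_self_eq_norm_sq, norm_expSeries hS hE]
  ring

theorem expL_add (s t : ℝ) (x : H) : expL hE (s + t) x = expL hE s (expL hE t x) :=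
  hj.induction_on (p := fun x => expL hE (s + t) x = expL hE s (expL hE t x)) x
    (isClosed_eq (by fun_prop) (by fun_prop)) fun ψ => by
      rw [expL_apply hj hS, expL_apply hj hS, expL_expSeries hj hS]

theorem expL_zero (x : H) : expL hE 0 x = x :=
  hj.induction_on (p := fun x => expL hE 0 x = x) x
    (isClosed_eq (by fun_prop) (by fun_prop)) fun ψ => by
      rw [expL_apply hj hS, expSeries_zero]

theorem continuous_expL (x : H) : Continuous fun t => expL hE t x := by
  refine hj.induction_on (p := fun x => Continuous fun t => expL hE t x) x ?_ fun ψ => ?_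
  · rw [← isSeqClosed_iff_isClosed]
    intro x y hx hxy
    refine TendstoUniformly.continuous (F := fun n t => expL hE t (x n)) (p := atTop) ?_
      (Frequently.of_forall hx)
    rw [Metric.tendstoUniformly_iff]
    intro ε hε
    filter_upwards [Metric.tendsto_atTop'.1 hxy ε hε |>.elim
      fun N hN => eventually_gt_atTop N |>.mono hN] with n hn t
    rw [dist_comm, dist_eq_norm, ← map_sub, norm_expL hj hS, ← dist_eq_norm]
    exact hn
  · simp only [expL_apply hj hS]
    exact continuous_iff_continuousAt.2 fun t => ((hE ψ).hasDerivAt t).continuousAt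

/-- `e^{itS}` as a unitary operator. -/
def expUnitary (t : ℝ) : H ≃ₗᵢ[ℂ] H :=
  LinearIsometryEquiv.ofSurjective ⟨(expL hE t).toLinearMap, norm_expL hj hS hE t⟩ fun x =>
    ⟨expL hE (-t) x, by
      change expL hE t _ = _
      rw [← expL_add hj hS, add_neg_cancel, expL_zero hj hS]⟩

theorem expUnitary_apply (t : ℝ) (x : H) : expUnitary hj hS hE t x = expL hE t x := rfl

/-- Approximate `(x, y)` by points of the graph of `S`. Since `expL` is isometric, the derivatives
converge uniformly in `t`, and differentiation passes to the limit. -/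
theorem hasDerivAt_expL {x y : H} (h : (x, y) ∈ closedGraph j S) (t : ℝ) :
    HasDerivAt (fun t => expL hE t x) (Complex.I • expL hE t y) t := by
  rw [closedGraph, ← SetLike.mem_coe, Submodule.topologicalClosure_coe,
    mem_closure_iff_seq_limit] at h
  obtain ⟨z, hz, hlim⟩ := h
  choose ψ hψ using hz
  have hlim' : Tendsto (fun n => (j (ψ n), j (S (ψ n)))) atTop (𝓝 (x, y)) := by
    convert hlim using 2 with n
    exact hψ n
  have hx := (continuous_fst.tendsto _).comp hlim'
  have hy := (continuous_snd.tendsto _).comp hlim'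
  refine hasDerivAt_of_tendstoUniformly (𝕜 := ℝ) (l := atTop)
    (g := fun t => expL hE t x) (g' := fun t => Complex.I • expL hE t y)
    (f := fun n t => expL hE t (j (ψ n)))
    (f' := fun n t => Complex.I • expL hE t (j (S (ψ n)))) ?_ ?_ ?_ t
  · rw [Metric.tendstoUniformly_iff]
    intro ε hε
    filter_upwards [Metric.tendsto_nhds.1 hy ε hε] with n hn t
    rw [dist_comm, dist_eq_norm, ← smul_sub, ← map_sub, norm_smul, Complex.norm_I, one_mul,
      norm_expL hj hS, ← dist_eq_norm]
    exact hn
  · refine Eventually.of_forall fun n t => ?_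
    simp only [expL_apply hj hS]
    exact (hE (ψ n)).hasDerivAt t
  · intro t
    exact ((expL hE t).continuous.tendsto x).comp hx

-- The cross term drops out because `⟪y, x⟫` is real for a symmetric operator.
omit hj [CompleteSpace H] in
theorem norm_sub_smul_of_mem_closedGraph {x y : H} (h : (x, y) ∈ closedGraph j S) :
    ‖y - Complex.I • x‖ ^ 2 = ‖y‖ ^ 2 + ‖x‖ ^ 2 := by
  have h1 := inner_closedGraph hS h h
  have h2 : (⟪y, x⟫_ℂ).im = 0 := by
    rw [← Complex.conj_eq_iff_im, inner_conj_symm, h1]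
  rw [@norm_sub_sq ℂ, norm_smul, Complex.norm_I, inner_smul_right]
  simp [h2]

-- Triviality of a deficiency space. The hypothesis forces `⟪ξ, e^{itS} ψ⟫ = e^{-t} ⟪ξ, ψ⟫`, which
-- is unbounded as `t → -∞` unless `⟪ξ, ψ⟫ = 0`, whereas `e^{itS} ψ` has constant norm.
omit hS in
include hE in
theorem eq_zero_of_inner_apply_eq {ξ : H}
    (hξ : ∀ ψ, ⟪ξ, j (S ψ)⟫_ℂ = Complex.I * ⟪ξ, j ψ⟫_ℂ)
    (hS : ∀ ψ φ, ⟪j (S ψ), j φ⟫_ℂ = ⟪j ψ, j (S φ)⟫_ℂ) : ξ = 0 := by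
  refine hj.eq_zero_of_inner_left ℂ fun ψ => ?_
  have hpow : ∀ n, ⟪ξ, j ((S ^ n) ψ)⟫_ℂ = Complex.I ^ n * ⟪ξ, j ψ⟫_ℂ := by
    intro n
    induction n with
    | zero => simp
    | succ n ih => rw [pow_succ', Module.End.mul_apply, hξ, ih]; ring
  have hexp : ∀ t : ℝ, ⟪ξ, expSeries j S t ψ⟫_ℂ = Complex.exp (-t) * ⟪ξ, j ψ⟫_ℂ := by
    intro t
    have h1 := (innerSL ℂ ξ).hasSum ((hE ψ).hasSum t)
    have h2 := (NormedSpace.expSeries_div_hasSum_exp (-(t : ℂ))).mul_right ⟪ξ, j ψ⟫_ℂ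
    rw [← Complex.exp_eq_exp_ℂ] at h2
    refine HasSum.unique h1 (h2.congr_fun fun n => ?_)
    rw [innerSL_apply_apply, inner_smul_right, hpow, div_mul_eq_mul_div,
      div_mul_eq_mul_div, ← mul_assoc, ← mul_pow]
    congr 3
    linear_combination (t : ℂ) * Complex.I_mul_I
  by_contra hne
  have hpos : 0 < ‖⟪ξ, j ψ⟫_ℂ‖ := norm_pos_iff.2 hne
  have hle : ∀ t : ℝ, Real.exp t * ‖⟪ξ, j ψ⟫_ℂ‖ ≤ ‖ξ‖ * ‖j ψ‖ := by
    intro t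
    have h1 := norm_inner_le_norm (𝕜 := ℂ) ξ (expSeries j S (-t) ψ)
    rwa [norm_expSeries hS hE, hexp, norm_mul, Complex.norm_exp, Complex.ofReal_neg, neg_neg,
      Complex.ofReal_re] at h1
  obtain ⟨t, ht⟩ := (Real.tendsto_exp_atTop.eventually_gt_atTop
    (‖ξ‖ * ‖j ψ‖ / ‖⟪ξ, j ψ⟫_ℂ‖)).exists
  rw [div_lt_iff₀ hpos] at ht
  exact absurd (hle t) (not_le.2 ht)

include hE in
/-- `S - i` maps the domain of the closure of `S` onto the whole space. -/
theorem exists_mem_closedGraph_sub_smul (z : H) :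
    ∃ x y, (x, y) ∈ closedGraph j S ∧ y - Complex.I • x = z := by
  let L : H × H →L[ℂ] H :=
    ContinuousLinearMap.snd ℂ H H - Complex.I • ContinuousLinearMap.fst ℂ H H
  let M : closedGraph j S →L[ℂ] H := L.comp (closedGraph j S).subtypeL
  have hM : ∀ w, ‖w‖ ≤ ((1 : NNReal) : ℝ) * ‖M w‖ := by
    rintro ⟨⟨x, y⟩, h⟩
    have h1 := norm_sub_smul_of_mem_closedGraph hS h
    rw [NNReal.coe_one, one_mul]
    change max ‖x‖ ‖y‖ ≤ ‖y - Complex.I • x‖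
    refine max_le ?_ ?_ <;> refine le_of_sq_le_sq ?_ (norm_nonneg _) <;> rw [h1] <;>
      nlinarith [sq_nonneg ‖x‖, sq_nonneg ‖y‖]
  have : CompleteSpace (closedGraph j S) :=
    (Submodule.isClosed_topologicalClosure _).completeSpace_coe
  -- The closed graph is complete and `M` is bounded below on it, so the range is closed;
  -- surjectivity then reduces to a trivial orthogonal complement.
  have hcl : IsClosed (Set.range M) :=
    (M.antilipschitz_of_bound hM).isClosed_range M.uniformContinuous
  have hrange : (LinearMap.range M.toLinearMap)ᗮ = ⊥ := by
    rw [Submodule.eq_bot_iff]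
    intro ξ hξ
    refine eq_zero_of_inner_apply_eq hj hE (fun ψ => ?_) hS
    have h1 := (Submodule.mem_orthogonal' _ _).1 hξ _
      ⟨⟨_, mem_closedGraph (j := j) (S := S) ψ⟩, rfl⟩
    change ⟪ξ, j (S ψ) - Complex.I • j ψ⟫_ℂ = 0 at h1
    rwa [inner_sub_right, inner_smul_right, sub_eq_zero] at h1
  have htop : LinearMap.range M.toLinearMap = ⊤ := by
    rw [← (show IsClosed (LinearMap.range M.toLinearMap : Set H) from
      hcl).submodule_topologicalClosure_eq, Submodule.topologicalClosure_eq_top_iff, hrange]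
  obtain ⟨⟨⟨x, y⟩, h⟩, hw⟩ := LinearMap.range_eq_top.1 htop z
  exact ⟨x, y, h, hw⟩

theorem isUnitaryGroup_expUnitary : IsUnitaryGroup (closedGraph j S) (expUnitary hj hS hE) where
  add s t x := expL_add hj hS hE s t x
  continuous x := continuous_expL hj hS hE x
  generator x y := by
    refine ⟨fun h => ?_, fun h => ?_⟩
    · have := hasDerivAt_expL hj hS hE h 0
      rwa [expL_zero hj hS] at this
    -- The generator might a priori extend the closure of `S`. Choose a point of the closed graph
    -- with the same image under `S - i`: the difference `x - x'` is then an eigenvector of the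
    -- generator for the eigenvalue `i`. The squared norm of its orbit is constant, yet has
    -- derivative `-2 ‖x - x'‖²` at `0`, so `x = x'`.
    · obtain ⟨x', y', h', he⟩ := exists_mem_closedGraph_sub_smul hj hS hE (y - Complex.I • x)
      have h1 := hasDerivAt_expL hj hS hE h' 0
      rw [expL_zero hj hS] at h1
      have h2 : HasDerivAt (fun t => expL hE t (x - x')) (Complex.I • (y - y')) 0 := by
        simp only [map_sub, smul_sub]
        exact h.sub h1
      have hy : y - y' = Complex.I • (x - x') := by
        rw [smul_sub, sub_eq_sub_iff_sub_eq_sub, ← he]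
      have h3 := h2.inner ℂ h2
      have h4 : (fun t => ⟪expL hE t (x - x'), expL hE t (x - x')⟫_ℂ) =
          fun _ => ⟪x - x', x - x'⟫_ℂ := by
        ext t
        rw [inner_self_eq_norm_sq_to_K, norm_expL hj hS, inner_self_eq_norm_sq_to_K]
      rw [h4] at h3
      have h5 := h3.unique (hasDerivAt_const _ _)
      rw [expL_zero hj hS, hy, smul_smul, Complex.I_mul_I, inner_smul_left, inner_smul_right] at h5
      have h6 : ⟪x - x', x - x'⟫_ℂ = 0 := by
        simp only [map_neg, map_one] at h5
        linear_combination (-1 / 2 : ℂ) * h5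
      have h7 : x - x' = 0 := inner_self_eq_zero.1 h6
      rw [h7, smul_zero] at hy
      rwa [sub_eq_zero.1 h7, sub_eq_zero.1 hy]

end EntireVectors

/-! ### Uniqueness of the unitary group with a given generator. -/

section Uniqueness

variable {E : Type*} [NormedAddCommGroup E] [InnerProductSpace ℂ E] {A : Submodule ℂ (E × E)}
  {U V : ℝ → E ≃ₗᵢ[ℂ] E}

theorem IsUnitaryGroup.zero (hU : IsUnitaryGroup A U) (x : E) : U 0 x = x :=
  (U 0).injective (by rw [← hU.add, add_zero])

theorem IsUnitaryGroup.hasDerivAt (hU : IsUnitaryGroup A U) {x y : E} (h : (x, y) ∈ A) (t : ℝ) :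
    HasDerivAt (fun t => U t x) (Complex.I • U t y) t := by
  have h0 := (hU.generator x y).1 h
  have h1 : HasDerivAt (fun s => U (s - t) x) (Complex.I • y) t := by
    have h2 : HasDerivAt (fun t => U t x) (Complex.I • y) (t - t) := by rwa [sub_self]
    exact h2.comp_sub_const t t
  have h2 := ((U t).toContinuousLinearEquiv.toContinuousLinearMap.restrictScalars
    ℝ).hasFDerivAt.comp_hasDerivAt t h1
  convert h2 using 1
  · ext s
    change U s x = U t (U (s - t) x)
    rw [← hU.add, add_sub_cancel]
  · exact (map_smul (U t) _ _).symm

theorem IsUnitaryGroup.apply_mem (hU : IsUnitaryGroup A U) {x y : E} (h : (x, y) ∈ A) (t : ℝ) :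
    (U t x, U t y) ∈ A := by
  rw [hU.generator]
  have h2 := ((U t).toContinuousLinearEquiv.toContinuousLinearMap.restrictScalars
    ℝ).hasFDerivAt.comp_hasDerivAt 0 ((hU.generator x y).1 h)
  convert h2 using 1
  · ext s
    change U s (U t x) = U t (U s x)
    rw [← hU.add, ← hU.add, add_comm]
  · exact (map_smul (U t) _ _).symm

/-- Symmetry of the generator comes from differentiating the constant function `t ↦ ⟪U t x, U t x'⟫`
at `0`. -/
theorem IsUnitaryGroup.inner_eq (hU : IsUnitaryGroup A U) {x y x' y' : E} (h : (x, y) ∈ A)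
    (h' : (x', y') ∈ A) : ⟪y, x'⟫_ℂ = ⟪x, y'⟫_ℂ := by
  have h1 := ((hU.generator x y).1 h).inner ℂ ((hU.generator x' y').1 h')
  have h2 : (fun t => ⟪U t x, U t x'⟫_ℂ) = fun _ => ⟪x, x'⟫_ℂ := by
    ext t
    simp
  rw [h2] at h1
  have h3 := h1.unique (hasDerivAt_const _ _)
  rw [hU.zero, hU.zero, inner_smul_left, inner_smul_right, Complex.conj_I] at h3
  have h4 : Complex.I * (⟪x, y'⟫_ℂ - ⟪y, x'⟫_ℂ) = 0 := by linear_combination h3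
  have h5 := (mul_eq_zero.1 h4).resolve_left Complex.I_ne_zero
  exact (sub_eq_zero.1 h5).symm

/-- The unitary group of a densely defined operator is unique. -/
theorem IsUnitaryGroup.eq (hU : IsUnitaryGroup A U) (hV : IsUnitaryGroup A V)
    (hA : Dense {x : E | ∃ y, (x, y) ∈ A}) (t : ℝ) (x : E) : U t x = V t x := by
  have key : ∀ x' ∈ {x : E | ∃ y, (x, y) ∈ A}, ∀ x ∈ {x : E | ∃ y, (x, y) ∈ A},
      ⟪x', U t x⟫_ℂ = ⟪x', V t x⟫_ℂ := by
    rintro x' ⟨y', h'⟩ x ⟨y, h⟩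
    -- Interpolates between `⟪x', U t x⟫` at `r = 0` and `⟪V (-t) x', x⟫` at `r = t`. Both groups
    -- preserve the domain of the generator, so symmetry makes the derivative vanish.
    let f : ℝ → ℂ := fun r => ⟪V (-r) x', U (t - r) x⟫_ℂ
    have hf : ∀ r, HasDerivAt f 0 r := by
      intro r
      have h1 := (hV.hasDerivAt h' (-r)).scomp r (hasDerivAt_neg r)
      have h2 := (hU.hasDerivAt h (t - r)).scomp r ((hasDerivAt_id r).const_sub t)
      have h3 := h1.inner ℂ h2
      refine HasDerivAt.congr_deriv (f := f) h3 ?_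
      have := hV.inner_eq (hV.apply_mem h' (-r)) (hU.apply_mem h (t - r))
      simp [inner_smul_left, inner_smul_right, this]
    have hc := is_const_of_deriv_eq_zero (fun r => (hf r).differentiableAt)
      (fun r => (hf r).deriv) 0 t
    simp only [f, sub_zero, neg_zero, sub_self, hU.zero, hV.zero] at hc
    rw [hc, ← LinearIsometryEquiv.inner_map_map (V t) (V (-t) x') x, ← hV.add, add_neg_cancel,
      hV.zero]
  refine hA.denseRange_val.induction_on (p := fun x => U t x = V t x) x
    (isClosed_eq (U t).continuous (V t).continuous) fun ⟨x, hx⟩ => ?_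
  refine hA.eq_of_inner_right ℂ fun x' hx' => ?_
  exact key x' hx' x hx

/-- On entire vectors of an essentially self-adjoint `S`, `e^{itS}` is the exponential series. -/
theorem expI_closedGraph {D : Type*} [AddCommGroup D] [Module ℂ D] [CompleteSpace E]
    {j : D →ₗ[ℂ] E} {S : Module.End ℂ D} (hj : DenseRange j)
    (hS : ∀ ψ φ, ⟪j (S ψ), j φ⟫_ℂ = ⟪j ψ, j (S φ)⟫_ℂ) (hE : ∀ ψ, IsEntireVector j S ψ)
    (t : ℝ) (ψ : D) : expI (closedGraph j S) t (j ψ) = expSeries j S t ψ := by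
  have hex : ∃ U, IsUnitaryGroup (closedGraph j S) U :=
    ⟨_, isUnitaryGroup_expUnitary hj hS hE⟩
  rw [expI, dif_pos hex, hex.choose_spec.eq (isUnitaryGroup_expUnitary hj hS hE) ?_,
    expUnitary_apply, expL_apply hj hS]
  refine hj.mono ?_
  rintro _ ⟨φ, rfl⟩
  exact ⟨_, mem_closedGraph φ⟩

end Uniqueness

/-! ### (Anti)commutation relations and adjoints -/

section Sectors

variable {K : Type u} [NormedAddCommGroup K] [InnerProductSpace ℂ K]

/-- Reversing the order of insertion makes `f` and `g` pass each other once, which costs one factor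
`ε`. -/
theorem insertion_comm {ε : ℂ} (hε : ε * ε = 1) (f g : K) (n : ℕ) (x : TPow K n) :
    insertion ε f (n + 1) (insertion ε g n x) = ε • insertion ε g (n + 1) (insertion ε f n x) := by
  induction n with
  | zero =>
    change insertion ε f 1 (consTensor K 0 (g ⊗ₜ x)) =
      ε • insertion ε g 1 (consTensor K 0 (f ⊗ₜ x))
    rw [insertion_consTensor, insertion_consTensor, smul_add, smul_smul, hε, one_smul]
    exact add_comm _ _
  | succ n ih =>
    obtain ⟨y, rfl⟩ := (consTensor K n).surjective x
    induction y using TensorProduct.induction_on with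
    | zero => simp
    | tmul h z =>
      simp only [insertion_consTensor, map_add, map_smul, ih z, TensorProduct.tmul_smul, smul_add,
        smul_smul, hε, one_smul, TensorProduct.tmul_add]
      abel
    | add a b ha hb => simp only [map_add, ha, hb, smul_add]

/-- Contraction always acts on the first tensor factor, so exchanging two contractions needs the
symmetry of `x`. On the spanning insertions it follows from `contract_insertion_succ`. -/
theorem contract_comm {ε : ℂ} (hε : ε * ε = 1) (f g : K) (n : ℕ) {x : TPow K (n + 2)}
    (hx : x ∈ sector ε (n + 2)) :
    contract f n (contract g (n + 1) x) = ε • contract g n (contract f (n + 1) x) := by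
  induction n with
  | zero =>
    refine Submodule.span_induction ?_ (by simp) (fun a b _ _ ha hb => by
      simp only [map_add, ha, hb, smul_add]) (fun c a _ ha => by
      simp only [map_smul, ha, smul_comm c]) hx
    rintro _ ⟨k, y, -, rfl⟩
    simp only [contract_insertion_succ, contract_insertion_zero, map_add, map_smul, smul_add,
      smul_smul, ← mul_assoc, hε, one_mul]
    abel
  | succ n ih =>
    refine Submodule.span_induction ?_ (by simp) (fun a b _ _ ha hb => by
      simp only [map_add, ha, hb, smul_add]) (fun c a _ ha => by
      simp only [map_smul, ha, smul_comm c]) hx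
    rintro _ ⟨k, y, hy, rfl⟩
    simp only [contract_insertion_succ, map_add, map_smul, ih hy, smul_add,
      smul_smul, ← mul_assoc, hε, one_mul]
    abel

theorem inner_consTensor_left (f : K) (n : ℕ) (x : TPow K n) (y : TPow K (n + 1)) :
    ⟪consTensor K n (f ⊗ₜ[ℂ] x), y⟫_ℂ = ⟪x, contract f n y⟫_ℂ := by
  obtain ⟨y, rfl⟩ := (consTensor K n).surjective y
  rw [LinearIsometryEquiv.inner_map_map]
  induction y using TensorProduct.induction_on with
  | zero => simp
  | tmul h z => rw [contract_consTensor, TensorProduct.inner_tmul, inner_smul_right]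
  | add a b ha hb => simp only [map_add, inner_add_right, ha, hb]

/-- Against an (anti)symmetric `y`, each of the `n + 1` insertion positions contributes the same
amount; the sign `ε` of a position is cancelled by `contract_comm`. -/
theorem inner_insertion_left {ε : ℂ} (hε : ε * ε = 1) (hε' : (starRingEnd ℂ) ε = ε) (f : K)
    (n : ℕ) (x : TPow K n) {y : TPow K (n + 1)} (hy : y ∈ sector ε (n + 1)) :
    ⟪insertion ε f n x, y⟫_ℂ = (n + 1) * ⟪x, contract f n y⟫_ℂ := by
  induction n with
  | zero =>
    change ⟪consTensor K 0 (f ⊗ₜ x), y⟫_ℂ = _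
    rw [inner_consTensor_left]
    simp
  | succ n ih =>
    obtain ⟨x, rfl⟩ := (consTensor K n).surjective x
    induction x using TensorProduct.induction_on with
    | zero => simp
    | tmul h z =>
      rw [insertion_consTensor, inner_add_left, inner_smul_left, inner_consTensor_left,
        inner_consTensor_left h, inner_consTensor_left h, ih z (contract_mem ε h (n + 1) y hy), contract_comm hε f h n hy,
        inner_smul_right, hε']
      push_cast
      linear_combination ((n : ℂ) + 1) * ⟪z, contract h n (contract f (n + 1) y)⟫_ℂ * hε
    | add a b ha hb => simp only [map_add, inner_add_left, ha, hb, mul_add]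

/-- Cauchy–Schwarz for `‖contract f n x‖² = ⟪f ⊗ contract f n x, x⟫`, followed by division by
`‖contract f n x‖`. -/
theorem norm_contract_le (f : K) (n : ℕ) (x : TPow K (n + 1)) :
    ‖contract f n x‖ ≤ ‖f‖ * ‖x‖ := by
  have h := norm_inner_le_norm (𝕜 := ℂ) (consTensor K n (f ⊗ₜ[ℂ] contract f n x)) x
  rw [inner_consTensor_left, inner_self_eq_norm_sq_to_K, LinearIsometryEquiv.norm_map,
    TensorProduct.norm_tmul] at h
  simp only [Complex.coe_algebraMap, norm_pow, Complex.norm_real, norm_norm] at h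
  rcases (norm_nonneg (contract f n x)).eq_or_lt with h0 | h0
  · rw [← h0]; positivity
  · nlinarith

theorem sqrt_succ_ne_zero (n : ℕ) : (Real.sqrt (n + 1) : ℂ) ≠ 0 := by
  rw [Complex.ofReal_ne_zero]
  positivity

theorem sqrt_succ_mul_self (n : ℕ) :
    (Real.sqrt (n + 1) : ℂ) * (Real.sqrt (n + 1) : ℂ) = n + 1 := by
  rw [← Complex.ofReal_mul, Real.mul_self_sqrt (by positivity)]
  push_cast
  rfl

theorem coe_create (ε : ℂ) (f : K) (n : ℕ) (x : sector (K := K) ε n) :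
    (create ε f n x : TPow K (n + 1)) = (Real.sqrt (n + 1) : ℂ)⁻¹ • insertion ε f n x := rfl

theorem coe_annihilate (ε : ℂ) (f : K) (n : ℕ) (x : sector (K := K) ε (n + 1)) :
    (annihilate ε f n x : TPow K n) = (Real.sqrt (n + 1) : ℂ) • contract f n x := rfl

theorem inner_create_left {ε : ℂ} (hε : ε * ε = 1) (hε' : (starRingEnd ℂ) ε = ε) (f : K)
    (n : ℕ) (x : sector (K := K) ε n) (y : sector (K := K) ε (n + 1)) :
    ⟪create ε f n x, y⟫_ℂ = ⟪x, annihilate ε f n y⟫_ℂ := by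
  rw [Submodule.coe_inner, Submodule.coe_inner, coe_create, coe_annihilate, inner_smul_left,
    inner_smul_right, inner_insertion_left hε hε' f n _ y.2, map_inv₀, Complex.conj_ofReal,
    ← sqrt_succ_mul_self]
  field_simp [sqrt_succ_ne_zero n]

theorem norm_annihilate_le (ε : ℂ) (f : K) (n : ℕ) (x : sector (K := K) ε (n + 1)) :
    ‖annihilate ε f n x‖ ≤ Real.sqrt (n + 1) * ‖f‖ * ‖x‖ := by
  rw [Submodule.coe_norm, coe_annihilate, norm_smul, Complex.norm_real, Real.norm_eq_abs,
    abs_of_nonneg (Real.sqrt_nonneg _), mul_assoc]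
  exact mul_le_mul_of_nonneg_left (norm_contract_le f n x) (Real.sqrt_nonneg _)

theorem norm_create_le {ε : ℂ} (hε : ε * ε = 1) (hε' : (starRingEnd ℂ) ε = ε) (f : K) (n : ℕ)
    (x : sector (K := K) ε n) : ‖create ε f n x‖ ≤ Real.sqrt (n + 1) * ‖f‖ * ‖x‖ := by
  have h := norm_inner_le_norm (𝕜 := ℂ) x (annihilate ε f n (create ε f n x))
  rw [← inner_create_left hε hε', inner_self_eq_norm_sq_to_K] at h
  simp only [Complex.coe_algebraMap, norm_pow, Complex.norm_real, norm_norm] at h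
  have h1 := norm_annihilate_le ε f n (create ε f n x)
  rcases (norm_nonneg (create ε f n x)).eq_or_lt with h0 | h0
  · rw [← h0]; positivity
  · have h2 : ‖create ε f n x‖ ^ 2 ≤
        ‖x‖ * (Real.sqrt (n + 1) * ‖f‖ * ‖create ε f n x‖) :=
      h.trans (mul_le_mul_of_nonneg_left h1 (norm_nonneg _))
    nlinarith

theorem annihilate_create_zero (ε : ℂ) (g f : K) (x : sector (K := K) ε 0) :
    annihilate ε g 0 (create ε f 0 x) = ⟪g, f⟫_ℂ • x := by
  apply Subtype.ext
  rw [coe_annihilate, coe_create, map_smul, smul_smul, mul_inv_cancel₀ (sqrt_succ_ne_zero 0),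
    one_smul, contract_insertion_zero]
  rfl

theorem annihilate_create_succ (ε : ℂ) (g f : K) (n : ℕ) (x : sector (K := K) ε (n + 1)) :
    annihilate ε g (n + 1) (create ε f (n + 1) x) =
      ⟪g, f⟫_ℂ • x + ε • create ε f n (annihilate ε g n x) := by
  apply Subtype.ext
  rw [coe_annihilate, coe_create, map_smul, smul_smul,
    mul_inv_cancel₀ (sqrt_succ_ne_zero (n + 1)), one_smul, contract_insertion_succ]
  rw [Submodule.coe_add, Submodule.coe_smul, Submodule.coe_smul, coe_create, coe_annihilate,
    map_smul, smul_smul _ _ (insertion ε f n _), inv_mul_cancel₀ (sqrt_succ_ne_zero n), one_smul]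

theorem annihilate_comm {ε : ℂ} (hε : ε * ε = 1) (f g : K) (n : ℕ)
    (x : sector (K := K) ε (n + 2)) :
    annihilate ε f n (annihilate ε g (n + 1) x) =
      ε • annihilate ε g n (annihilate ε f (n + 1) x) := by
  apply Subtype.ext
  rw [Submodule.coe_smul]
  simp only [coe_annihilate, map_smul, contract_comm hε f g n x.2, smul_smul]
  congr 1
  ring

end Sectors

/-! ### The Segal field on the finite particle space -/

section Bosons

variable {K : Type u} [NormedAddCommGroup K] [InnerProductSpace ℂ K]

/-- The inclusion of the `n`-particle space in the finite particle space. -/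
abbrev bosonLof (n : ℕ) : sector (K := K) (1 : ℂ) n →ₗ[ℂ] BosonFin K :=
  DirectSum.lof ℂ ℕ (fun n => sector (K := K) (1 : ℂ) n) n

theorem bosonEmbed_lof (n : ℕ) (x : sector (K := K) (1 : ℂ) n) :
    bosonEmbed K (bosonLof n x) =
      lp.single (E := fun n : ℕ => UniformSpace.Completion (sector (K := K) (1 : ℂ) n)) 2 n
        (x : UniformSpace.Completion (sector (K := K) (1 : ℂ) n)) := by
  rw [bosonEmbed, DirectSum.toModule_lof]
  rfl

theorem inner_bosonEmbed_lof_same (n : ℕ) (x y : sector (K := K) (1 : ℂ) n) :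
    ⟪bosonEmbed K (bosonLof n x), bosonEmbed K (bosonLof n y)⟫_ℂ = ⟪x, y⟫_ℂ := by
  rw [bosonEmbed_lof, bosonEmbed_lof, lp.inner_single_left, lp.single_apply_self,
    UniformSpace.Completion.inner_coe]

theorem inner_bosonEmbed_lof_ne {n m : ℕ} (h : n ≠ m) (x : sector (K := K) (1 : ℂ) n)
    (y : sector (K := K) (1 : ℂ) m) :
    ⟪bosonEmbed K (bosonLof n x), bosonEmbed K (bosonLof m y)⟫_ℂ = 0 := by
  rw [bosonEmbed_lof, bosonEmbed_lof, lp.inner_single_left, lp.single_apply_ne _ _ _ h,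
    inner_zero_right]

theorem norm_bosonEmbed_lof (n : ℕ) (x : sector (K := K) (1 : ℂ) n) :
    ‖bosonEmbed K (bosonLof n x)‖ = ‖x‖ := by
  rw [bosonEmbed_lof, lp.norm_single (by norm_num), UniformSpace.Completion.norm_coe]

theorem bosonCreate_lof (f : K) (n : ℕ) (x : sector (K := K) (1 : ℂ) n) :
    bosonCreate f (bosonLof n x) = bosonLof (n + 1) (create 1 f n x) := by
  rw [bosonCreate, DirectSum.toModule_lof]
  rfl

theorem bosonAnnihilate_lof_zero (f : K) (x : sector (K := K) (1 : ℂ) 0) :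
    bosonAnnihilate f (bosonLof 0 x) = 0 := by
  rw [bosonAnnihilate, DirectSum.toModule_lof]
  rfl

theorem bosonAnnihilate_lof_succ (f : K) (n : ℕ) (x : sector (K := K) (1 : ℂ) (n + 1)) :
    bosonAnnihilate f (bosonLof (n + 1) x) = bosonLof n (annihilate 1 f n x) := by
  rw [bosonAnnihilate, DirectSum.toModule_lof]
  rfl

theorem bosonFin_induction {p : BosonFin K → Prop} (h0 : p 0)
    (hadd : ∀ ψ φ, p ψ → p φ → p (ψ + φ)) (h : ∀ n x, p (bosonLof n x)) (ψ : BosonFin K) : p ψ := by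
  induction ψ using DirectSum.induction_on with
  | zero => exact h0
  | of n x => exact h n x
  | add a b ha hb => exact hadd a b ha hb

theorem inner_bosonCreate_left (f : K) (ψ φ : BosonFin K) :
    ⟪bosonEmbed K (bosonCreate f ψ), bosonEmbed K φ⟫_ℂ =
      ⟪bosonEmbed K ψ, bosonEmbed K (bosonAnnihilate f φ)⟫_ℂ := by
  induction ψ using bosonFin_induction with
  | h0 => simp
  | hadd a b ha hb => simp only [map_add, inner_add_left, ha, hb]
  | h n x =>
    induction φ using bosonFin_induction with
    | h0 => simp
    | hadd a b ha hb => simp only [map_add, inner_add_right, ha, hb]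
    | h m y =>
      rw [bosonCreate_lof]
      rcases m with _ | m
      · rw [bosonAnnihilate_lof_zero, inner_bosonEmbed_lof_ne n.succ_ne_zero, map_zero,
          inner_zero_right]
      · rw [bosonAnnihilate_lof_succ]
        by_cases h : n = m
        · subst h
          rw [inner_bosonEmbed_lof_same, inner_bosonEmbed_lof_same,
            inner_create_left (by norm_num) (by simp)]
        · rw [inner_bosonEmbed_lof_ne h, inner_bosonEmbed_lof_ne (by omega)]

theorem inner_bosonAnnihilate_left (f : K) (ψ φ : BosonFin K) :
    ⟪bosonEmbed K (bosonAnnihilate f ψ), bosonEmbed K φ⟫_ℂ =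
      ⟪bosonEmbed K ψ, bosonEmbed K (bosonCreate f φ)⟫_ℂ := by
  rw [← inner_conj_symm, ← inner_bosonCreate_left, inner_conj_symm]

theorem bosonAnnihilate_bosonCreate (g f : K) (ψ : BosonFin K) :
    bosonAnnihilate g (bosonCreate f ψ) =
      ⟪g, f⟫_ℂ • ψ + bosonCreate f (bosonAnnihilate g ψ) := by
  induction ψ using bosonFin_induction with
  | h0 => simp
  | hadd a b ha hb =>
    simp only [map_add, ha, hb, smul_add]
    abel
  | h n x =>
    rw [bosonCreate_lof, bosonAnnihilate_lof_succ]
    rcases n with _ | n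
    · rw [bosonAnnihilate_lof_zero, annihilate_create_zero, map_smul, map_zero, add_zero]
    · rw [bosonAnnihilate_lof_succ, bosonCreate_lof, annihilate_create_succ, one_smul, map_add,
        map_smul]

theorem bosonAnnihilate_comm (g f : K) (ψ : BosonFin K) :
    bosonAnnihilate g (bosonAnnihilate f ψ) = bosonAnnihilate f (bosonAnnihilate g ψ) := by
  induction ψ using bosonFin_induction with
  | h0 => simp
  | hadd a b ha hb => simp only [map_add, ha, hb]
  | h n x =>
    rcases n with _ | _ | n
    · simp only [bosonAnnihilate_lof_zero, map_zero]
    · simp only [bosonAnnihilate_lof_succ, bosonAnnihilate_lof_zero]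
    · simp only [bosonAnnihilate_lof_succ]
      rw [annihilate_comm (by norm_num), one_smul]

theorem segalField_apply (f : K) (ψ : BosonFin K) :
    segalField f ψ = (Real.sqrt 2 : ℂ)⁻¹ • (bosonAnnihilate f ψ + bosonCreate f ψ) := rfl

theorem inner_segalField_left (f : K) (ψ φ : BosonFin K) :
    ⟪bosonEmbed K (segalField f ψ), bosonEmbed K φ⟫_ℂ =
      ⟪bosonEmbed K ψ, bosonEmbed K (segalField f φ)⟫_ℂ := by
  simp only [segalField_apply, map_smul, map_add, inner_smul_left, inner_smul_right,
    inner_add_left, inner_add_right, inner_bosonCreate_left, inner_bosonAnnihilate_left, map_inv₀,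
    Complex.conj_ofReal]
  ring

theorem bosonAnnihilate_segalField (h f : K) (ψ : BosonFin K) :
    bosonAnnihilate h (segalField f ψ) =
      ((Real.sqrt 2 : ℂ)⁻¹ * ⟪h, f⟫_ℂ) • ψ + segalField f (bosonAnnihilate h ψ) := by
  simp only [segalField_apply, map_smul, map_add, bosonAnnihilate_bosonCreate,
    bosonAnnihilate_comm h f, smul_add, smul_smul]
  abel

theorem denseRange_bosonEmbed : DenseRange (bosonEmbed K) := by
  let M := (LinearMap.range (bosonEmbed K)).topologicalClosure
  have hM : ∀ n (a : UniformSpace.Completion (sector (K := K) (1 : ℂ) n)),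
      lp.single (E := fun n : ℕ => UniformSpace.Completion (sector (K := K) (1 : ℂ) n)) 2 n a ∈
        M := by
    intro n a
    refine UniformSpace.Completion.denseRange_coe.induction_on (p := fun a => lp.single
      (E := fun n : ℕ => UniformSpace.Completion (sector (K := K) (1 : ℂ) n)) 2 n a ∈ M) a ?_ ?_
    · exact (Submodule.isClosed_topologicalClosure _).preimage
        (lp.isometry_single (E := fun n : ℕ => UniformSpace.Completion (sector (K := K) (1 : ℂ) n))
          (p := 2) n).continuous
    · intro x
      exact Submodule.le_topologicalClosure _ ⟨bosonLof n x, bosonEmbed_lof n x⟩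
  intro f
  have h : f ∈ M := (Submodule.isClosed_topologicalClosure _).mem_of_tendsto
    (lp.hasSum_single (by norm_num) f)
    (Eventually.of_forall fun s => Submodule.sum_mem _ fun n _ => hM n _)
  rwa [← SetLike.mem_coe, Submodule.topologicalClosure_coe] at h

/-- The innermost field moves the vector to the sectors `n + 1` and `n - 1`, whence the induction
over all `n`. Both branches obey the bound of the creation branch, and `2 / √2 = √2` gives the
constant. -/
theorem norm_segalField_pow_lof_le (f : K) (k n : ℕ) (x : sector (K := K) (1 : ℂ) n) :
    ‖bosonEmbed K ((segalField f ^ k) (bosonLof n x))‖ ≤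
      (Real.sqrt 2 * ‖f‖) ^ k * Real.sqrt ((n + k).factorial / n.factorial) * ‖x‖ := by
  induction k generalizing n with
  | zero =>
    have : (n.factorial : ℝ) ≠ 0 := by exact_mod_cast n.factorial_ne_zero
    simp [norm_bosonEmbed_lof, this]
  | succ k ih =>
    set C := Real.sqrt 2 * ‖f‖ with hC
    have hC0 : 0 ≤ C := by positivity
    set B := Real.sqrt ((n + (k + 1)).factorial / n.factorial)
    have hcreate : ‖bosonEmbed K ((segalField f ^ k) (bosonCreate f (bosonLof n x)))‖ ≤
        C ^ k * B * (‖f‖ * ‖x‖) := by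
      rw [bosonCreate_lof]
      refine (ih _ _).trans ?_
      have h1 := norm_create_le (ε := 1) (by norm_num) (by simp) f n x
      refine (mul_le_mul_of_nonneg_left h1 (by positivity)).trans (le_of_eq ?_)
      have h2 : Real.sqrt ((n + 1 + k).factorial / (n + 1).factorial) * Real.sqrt (n + 1) = B := by
        rw [← Real.sqrt_mul (by positivity)]
        congr 1
        rw [Nat.factorial_succ n, show n + 1 + k = n + (k + 1) by ring]
        push_cast
        field_simp
      rw [← h2]
      ring
    have hann : ‖bosonEmbed K ((segalField f ^ k) (bosonAnnihilate f (bosonLof n x)))‖ ≤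
        C ^ k * B * (‖f‖ * ‖x‖) := by
      rcases n with _ | n
      · rw [bosonAnnihilate_lof_zero, map_zero, map_zero, norm_zero]
        positivity
      · rw [bosonAnnihilate_lof_succ]
        refine (ih _ _).trans ?_
        have h1 := norm_annihilate_le 1 f n x
        refine (mul_le_mul_of_nonneg_left h1 (by positivity)).trans ?_
        have h2 : Real.sqrt ((n + k).factorial / n.factorial) * Real.sqrt (n + 1) ≤ B := by
          rw [← Real.sqrt_mul (by positivity)]
          refine Real.sqrt_le_sqrt ?_
          rw [div_mul_eq_mul_div, div_le_div_iff₀ (by positivity) (by positivity),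
            Nat.factorial_succ n, show n + 1 + (k + 1) = n + k + 1 + 1 by ring,
            Nat.factorial_succ (n + k + 1), Nat.factorial_succ (n + k)]
          push_cast
          have h3 : ((n : ℝ) + 1) * (n + 1) ≤ (n + k + 1 + 1) * (n + k + 1) := by
            have : (0 : ℝ) ≤ k := by positivity
            gcongr <;> linarith
          calc ((n + k).factorial : ℝ) * (n + 1) * ((n + 1) * n.factorial)
              = (n + 1) * (n + 1) * ((n + k).factorial * n.factorial) := by ring
            _ ≤ (n + k + 1 + 1) * (n + k + 1) * ((n + k).factorial * n.factorial) := by gcongr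
            _ = _ := by ring
        calc C ^ k * Real.sqrt ((n + k).factorial / n.factorial) *
              (Real.sqrt (n + 1) * ‖f‖ * ‖x‖)
            = C ^ k * (Real.sqrt ((n + k).factorial / n.factorial) * Real.sqrt (n + 1)) *
              (‖f‖ * ‖x‖) := by ring
          _ ≤ _ := by gcongr
    have h2 : (Real.sqrt 2)⁻¹ * 2 = Real.sqrt 2 := by
      rw [inv_mul_eq_div, Real.div_sqrt]
    rw [pow_succ, Module.End.mul_apply, segalField_apply, map_smul, map_smul, norm_smul, map_add,
      map_add, norm_inv, Complex.norm_real, Real.norm_eq_abs, abs_of_nonneg (Real.sqrt_nonneg _)]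
    calc (Real.sqrt 2)⁻¹ * _ ≤ (Real.sqrt 2)⁻¹ * (C ^ k * B * (‖f‖ * ‖x‖) +
          C ^ k * B * (‖f‖ * ‖x‖)) := by
          refine mul_le_mul_of_nonneg_left ?_ (by positivity)
          exact (norm_add_le _ _).trans (add_le_add hann hcreate)
      _ = ((Real.sqrt 2)⁻¹ * 2) * ‖f‖ * C ^ k * B * ‖x‖ := by ring
      _ = C ^ (k + 1) * B * ‖x‖ := by rw [h2, ← hC]; ring

/-- Since `(n + k)! / n! ≤ 2^(n+k) k!`, the square of each term is at most `2ⁿ p q` with `p =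
(8r²)^k / k!` and `q = (1/4)^k`. Then `√(p q) ≤ p + q`, and both series converge. -/
theorem summable_pow_div_factorial_mul_sqrt (n : ℕ) {r : ℝ} (hr : 0 ≤ r) :
    Summable fun k : ℕ =>
      r ^ k / k.factorial * Real.sqrt ((n + k).factorial / n.factorial) := by
  have h1 : Summable fun k : ℕ => (2 : ℝ) ^ n *
      ((8 * r ^ 2) ^ k / k.factorial + (1 / 4 : ℝ) ^ k) :=
    ((Real.summable_pow_div_factorial _).add
      (summable_geometric_of_lt_one (by norm_num) (by norm_num))).mul_left _
  refine Summable.of_nonneg_of_le (fun k => by positivity) (fun k => ?_) h1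
  have hk : (0 : ℝ) < k.factorial := by positivity
  have hle : ((n + k).factorial / n.factorial : ℝ) ≤ 2 ^ n * 2 ^ k * k.factorial := by
    rw [div_le_iff₀ (by positivity), ← pow_add]
    have h2 : (n + k).choose k ≤ 2 ^ (n + k) := Nat.choose_le_two_pow _ _
    have h3 := Nat.add_choose_mul_factorial_mul_factorial n k
    have h4 : (n + k).factorial ≤ 2 ^ (n + k) * k.factorial * n.factorial := by
      rw [← h3, mul_assoc, mul_assoc, mul_comm n.factorial]
      exact Nat.mul_le_mul_right _ h2
    exact_mod_cast h4
  have hp : 0 ≤ (8 * r ^ 2) ^ k / k.factorial := by positivity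
  have hq : 0 ≤ (1 / 4 : ℝ) ^ k := by positivity
  refine le_of_sq_le_sq ?_ (by positivity)
  rw [mul_pow, Real.sq_sqrt (by positivity)]
  have h8 : (8 : ℝ) ^ k * (1 / 4) ^ k = 2 ^ k := by rw [← mul_pow]; norm_num
  calc (r ^ k / k.factorial) ^ 2 * ((n + k).factorial / n.factorial)
      ≤ (r ^ k / k.factorial) ^ 2 * (2 ^ n * 2 ^ k * k.factorial) := by gcongr
    _ = 2 ^ n * ((8 * r ^ 2) ^ k / k.factorial * (1 / 4) ^ k) := by
      rw [← h8, mul_pow]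
      field_simp
      ring
    _ ≤ (2 ^ n) ^ 2 * ((8 * r ^ 2) ^ k / k.factorial + (1 / 4) ^ k) ^ 2 := by
      refine mul_le_mul (le_self_pow₀ (one_le_pow₀ (by norm_num)) (by norm_num)) ?_
        (by positivity) (by positivity)
      nlinarith [mul_nonneg hp hq]
    _ = _ := by ring

theorem isEntireVector_segalField (f : K) (ψ : BosonFin K) :
    IsEntireVector (bosonEmbed K) (segalField f) ψ := by
  induction ψ using bosonFin_induction with
  | h0 => exact isEntireVector_zero _ _
  | hadd a b ha hb => exact ha.add hb
  | h n x =>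
    intro r hr
    refine Summable.of_nonneg_of_le (fun k => by positivity) (fun k => ?_)
      ((summable_pow_div_factorial_mul_sqrt n
        (r := r * (Real.sqrt 2 * ‖f‖)) (by positivity)).mul_right ‖x‖)
    refine (mul_le_mul_of_nonneg_left (norm_segalField_pow_lof_le f k n x)
      (by positivity)).trans (le_of_eq ?_)
    rw [mul_pow]
    ring

end Bosons

/-! ### Coherent states -/

section Coherent

variable {K : Type u} [NormedAddCommGroup K] [InnerProductSpace ℂ K]

/-- The Fock vacuum in the finite particle space. -/
def vacuumFin (K : Type u) [NormedAddCommGroup K] [InnerProductSpace ℂ K] : BosonFin K :=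
  bosonLof 0 ⟨unitTensor K, unitTensor_mem K 1⟩

theorem bosonEmbed_vacuumFin : bosonEmbed K (vacuumFin K) = vacuum K := rfl

theorem norm_vacuum : ‖vacuum K‖ = 1 := by
  rw [← bosonEmbed_vacuumFin, vacuumFin, norm_bosonEmbed_lof, Submodule.coe_norm]
  change ‖EuclideanSpace.single (PUnit.unit : PUnit.{u + 1}) (1 : ℂ)‖ = 1
  simp

/-- `a(h)` kills the vacuum and has a scalar commutator with `φ(f)`, so it acts on `φ(f)ⁿ Ω` like a
derivative. For `n = 0` the truncated `n - 1` is harmless because the coefficient is zero. -/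
theorem bosonAnnihilate_segalField_pow_vacuum (h f : K) (n : ℕ) :
    bosonAnnihilate h ((segalField f ^ n) (vacuumFin K)) =
      (n * ((Real.sqrt 2 : ℂ)⁻¹ * ⟪h, f⟫_ℂ)) • (segalField f ^ (n - 1)) (vacuumFin K) := by
  induction n with
  | zero => simp [vacuumFin, bosonAnnihilate_lof_zero]
  | succ n ih =>
    rw [pow_succ', Module.End.mul_apply, bosonAnnihilate_segalField, ih, map_smul,
      Nat.add_sub_cancel]
    rcases n with _ | n
    · simp
    · rw [Nat.add_sub_cancel, ← Module.End.mul_apply, ← pow_succ', ← add_smul]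
      congr 1
      push_cast
      ring

/-- The Fock space matrix element `⟪ψ, e^{itφ(f)} Ω⟫`. -/
def coherentCoeff (f : K) (t : ℝ) (ψ : BosonFin K) : ℂ :=
  ⟪bosonEmbed K ψ, expSeries (bosonEmbed K) (segalField f) t (vacuumFin K)⟫_ℂ

theorem hasSum_coherentCoeff (f : K) (t : ℝ) (ψ : BosonFin K) :
    HasSum (fun n : ℕ => (Complex.I * t) ^ n / (n.factorial : ℂ) *
      ⟪bosonEmbed K ψ, bosonEmbed K ((segalField f ^ n) (vacuumFin K))⟫_ℂ)
      (coherentCoeff f t ψ) := by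
  have h := (innerSL ℂ (bosonEmbed K ψ)).hasSum
    ((isEntireVector_segalField f (vacuumFin K)).hasSum t)
  simp only [innerSL_apply_apply, inner_smul_right] at h
  exact h

/-- The coherent state is an eigenvector of every `a(h)`; here this is expressed in matrix elements,
by shifting the exponential series by one index. -/
theorem coherentCoeff_bosonCreate (f h : K) (t : ℝ) (ψ : BosonFin K) :
    coherentCoeff f t (bosonCreate h ψ) =
      Complex.I * t * ((Real.sqrt 2 : ℂ)⁻¹ * ⟪h, f⟫_ℂ) * coherentCoeff f t ψ := by
  refine (hasSum_coherentCoeff f t _).unique ?_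
  rw [← hasSum_nat_add_iff' 1]
  have h1 := (hasSum_coherentCoeff f t ψ).mul_left
    (Complex.I * t * ((Real.sqrt 2 : ℂ)⁻¹ * ⟪h, f⟫_ℂ))
  simp only [inner_bosonCreate_left, bosonAnnihilate_segalField_pow_vacuum, map_smul,
    inner_smul_right, Nat.add_sub_cancel, Finset.range_one, Finset.sum_singleton,
    Nat.cast_zero, zero_mul, mul_zero, sub_zero]
  refine h1.congr_fun fun n => ?_
  have : (n.factorial : ℂ) ≠ 0 := by exact_mod_cast n.factorial_ne_zero
  have : (n : ℂ) + 1 ≠ 0 := by exact_mod_cast n.succ_ne_zero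
  rw [Nat.factorial_succ]
  push_cast
  field_simp
  ring

theorem segalField_vacuumFin (f : K) :
    segalField f (vacuumFin K) = (Real.sqrt 2 : ℂ)⁻¹ • bosonCreate f (vacuumFin K) := by
  rw [segalField_apply, vacuumFin, bosonAnnihilate_lof_zero, zero_add]

theorem inv_sqrt_two_mul_self : (Real.sqrt 2 : ℂ)⁻¹ * (Real.sqrt 2 : ℂ)⁻¹ = 2⁻¹ := by
  rw [← mul_inv, ← Complex.ofReal_mul, Real.mul_self_sqrt (by norm_num)]
  norm_num

/-- This is the moment recursion of a centred Gaussian of variance `‖f‖² / 2`, the distribution of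
`φ(f)` in the vacuum. -/
theorem inner_vacuum_segalField_pow_succ (f : K) (n : ℕ) :
    ⟪vacuum K, bosonEmbed K ((segalField f ^ (n + 1)) (vacuumFin K))⟫_ℂ =
      n * (‖f‖ ^ 2 / 2) *
        ⟪vacuum K, bosonEmbed K ((segalField f ^ (n - 1)) (vacuumFin K))⟫_ℂ := by
  rw [pow_succ', Module.End.mul_apply, ← bosonEmbed_vacuumFin, ← inner_segalField_left,
    segalField_vacuumFin, map_smul, inner_smul_left, inner_bosonCreate_left,
    bosonAnnihilate_segalField_pow_vacuum, map_smul, inner_smul_right,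
    inner_self_eq_norm_sq_to_K, map_inv₀, Complex.conj_ofReal]
  simp only [Complex.coe_algebraMap]
  linear_combination n * (‖f‖ : ℂ) ^ 2 *
    ⟪bosonEmbed K (vacuumFin K), bosonEmbed K ((segalField f ^ (n - 1)) (vacuumFin K))⟫_ℂ *
    inv_sqrt_two_mul_self

theorem inner_vacuum_segalField_pow_odd (f : K) (n : ℕ) :
    ⟪vacuum K, bosonEmbed K ((segalField f ^ (2 * n + 1)) (vacuumFin K))⟫_ℂ = 0 := by
  induction n with
  | zero => rw [inner_vacuum_segalField_pow_succ]; simp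
  | succ n ih =>
    rw [inner_vacuum_segalField_pow_succ, show 2 * (n + 1) - 1 = 2 * n + 1 by omega, ih, mul_zero]

theorem inner_vacuum_segalField_pow_even (f : K) (n : ℕ) :
    ⟪vacuum K, bosonEmbed K ((segalField f ^ (2 * n)) (vacuumFin K))⟫_ℂ =
      (2 * n).factorial / n.factorial * (‖f‖ ^ 2 / 4) ^ n := by
  induction n with
  | zero =>
    rw [mul_zero, pow_zero, Module.End.one_apply, bosonEmbed_vacuumFin, inner_self_eq_norm_sq_to_K,
      norm_vacuum]
    simp
  | succ n ih =>
    rw [show 2 * (n + 1) = 2 * n + 1 + 1 by ring, inner_vacuum_segalField_pow_succ,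
      Nat.add_sub_cancel, ih, Nat.factorial_succ, Nat.factorial_succ, Nat.factorial_succ]
    have : (n.factorial : ℂ) ≠ 0 := by exact_mod_cast n.factorial_ne_zero
    have : (n : ℂ) + 1 ≠ 0 := by exact_mod_cast n.succ_ne_zero
    push_cast
    field_simp
    ring

/-- The Gaussian characteristic function: odd moments vanish, and in the even ones `(2n)!` cancels,
leaving an exponential series. -/
theorem coherentCoeff_vacuum (f : K) (t : ℝ) :
    coherentCoeff f t (vacuumFin K) = Complex.exp (-(t ^ 2 * ‖f‖ ^ 2 / 4)) := by
  refine (hasSum_coherentCoeff f t _).unique ?_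
  rw [bosonEmbed_vacuumFin]
  have h0 := NormedSpace.expSeries_div_hasSum_exp (-((t : ℂ) ^ 2 * ‖f‖ ^ 2 / 4))
  rw [← Complex.exp_eq_exp_ℂ] at h0
  rw [← add_zero (Complex.exp _)]
  refine HasSum.even_add_odd (h0.congr_fun fun n => ?_) ?_
  · rw [inner_vacuum_segalField_pow_even, pow_mul, mul_pow Complex.I, Complex.I_sq]
    have : ((2 * n).factorial : ℂ) ≠ 0 := by exact_mod_cast (2 * n).factorial_ne_zero
    have : (n.factorial : ℂ) ≠ 0 := by exact_mod_cast n.factorial_ne_zero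
    rw [show -((t : ℂ) ^ 2 * ‖f‖ ^ 2 / 4) = (-1 * t ^ 2) * (‖f‖ ^ 2 / 4) by ring,
      mul_pow (-1 * (t : ℂ) ^ 2)]
    field_simp
  · simp only [inner_vacuum_segalField_pow_odd, mul_zero]
    exact hasSum_zero

/-- Each creation operator in `x` contributes a factor at most proportional to `|t| ‖f‖`, and the
vacuum left at the end contributes the Gaussian. It is essential that `C` depends on `x` alone. -/
theorem exists_norm_coherentCoeff_le (n : ℕ) (x : sector (K := K) (1 : ℂ) n) :
    ∃ C : ℝ, ∀ (f : K) (t : ℝ), ‖coherentCoeff f t (bosonLof n x)‖ ≤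
      C * ((|t| * ‖f‖) ^ n * Real.exp (-((|t| * ‖f‖) ^ 2 / 4))) := by
  have hadd : ∀ (f : K) (t : ℝ) (ψ φ : BosonFin K),
      coherentCoeff f t (ψ + φ) = coherentCoeff f t ψ + coherentCoeff f t φ := fun f t ψ φ => by
    rw [coherentCoeff, map_add, inner_add_left]; rfl
  have hsmul : ∀ (f : K) (t : ℝ) (c : ℂ) (ψ : BosonFin K),
      coherentCoeff f t (c • ψ) = (starRingEnd ℂ) c * coherentCoeff f t ψ := fun f t c ψ => by
    rw [coherentCoeff, map_smul, inner_smul_left]; rfl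
  induction n with
  | zero =>
    obtain ⟨x, hx⟩ := x
    let x' : EuclideanSpace ℂ PUnit.{u + 1} := x
    refine ⟨‖x' PUnit.unit‖, fun f t => ?_⟩
    have h : bosonLof 0 (⟨x, hx⟩ : sector (K := K) (1 : ℂ) 0) =
        x' PUnit.unit • vacuumFin K := by
      rw [vacuumFin, ← map_smul]
      congr 1
      apply Subtype.ext
      change x' = x' PUnit.unit • EuclideanSpace.single PUnit.unit (1 : ℂ)
      ext i
      simp
    rw [h, hsmul, norm_mul, RCLike.norm_conj, coherentCoeff_vacuum, Complex.norm_exp, pow_zero,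
      one_mul, mul_pow, sq_abs]
    refine le_of_eq ?_
    congr 3
    norm_cast
  | succ n ih =>
    obtain ⟨x, hx⟩ := x
    refine Submodule.span_induction (p := fun x hx => ∃ C : ℝ, ∀ (f : K) (t : ℝ),
      ‖coherentCoeff f t (bosonLof (n + 1) (⟨x, hx⟩ : sector (K := K) (1 : ℂ) (n + 1)))‖ ≤
      C * ((|t| * ‖f‖) ^ (n + 1) * Real.exp (-((|t| * ‖f‖) ^ 2 / 4)))) ?_ ?_ ?_ ?_ hx
    · rintro _ ⟨h, y, hy, rfl⟩
      obtain ⟨C, hC⟩ := ih ⟨y, hy⟩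
      refine ⟨Real.sqrt (n + 1) * ((Real.sqrt 2)⁻¹ * ‖h‖) * C, fun f t => ?_⟩
      have h1 : bosonLof (n + 1) (⟨insertion 1 h n y, insertion_mem 1 h n y hy⟩ :
          sector (K := K) (1 : ℂ) (n + 1)) =
          (Real.sqrt (n + 1) : ℂ) • bosonCreate h (bosonLof n ⟨y, hy⟩) := by
        rw [bosonCreate_lof, ← map_smul]
        congr 1
        apply Subtype.ext
        rw [Submodule.coe_smul, coe_create, smul_smul, mul_inv_cancel₀ (sqrt_succ_ne_zero n),
          one_smul]
      rw [h1, hsmul, coherentCoeff_bosonCreate]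
      simp only [norm_mul, RCLike.norm_conj, norm_inv, Complex.norm_I, Complex.norm_real,
        Real.norm_eq_abs, abs_of_nonneg (Real.sqrt_nonneg _), one_mul]
      calc Real.sqrt (n + 1) * (|t| * ((Real.sqrt 2)⁻¹ * ‖⟪h, f⟫_ℂ‖) * _)
          ≤ Real.sqrt (n + 1) * (|t| * ((Real.sqrt 2)⁻¹ * (‖h‖ * ‖f‖)) *
            (C * ((|t| * ‖f‖) ^ n * Real.exp (-((|t| * ‖f‖) ^ 2 / 4))))) := by
            refine mul_le_mul_of_nonneg_left ?_ (Real.sqrt_nonneg _)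
            refine mul_le_mul ?_ (hC f t) (norm_nonneg _) (by positivity)
            have := norm_inner_le_norm (𝕜 := ℂ) h f
            gcongr
        _ = _ := by ring
    · refine ⟨0, fun f t => ?_⟩
      have : (⟨0, Submodule.zero_mem _⟩ : sector (K := K) (1 : ℂ) (n + 1)) = 0 := rfl
      rw [this, map_zero, coherentCoeff, map_zero, inner_zero_left, norm_zero, zero_mul]
    · rintro a b ha hb ⟨C, hC⟩ ⟨C', hC'⟩
      refine ⟨C + C', fun f t => ?_⟩
      have : (⟨a + b, Submodule.add_mem _ ha hb⟩ : sector (K := K) (1 : ℂ) (n + 1)) =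
        ⟨a, ha⟩ + ⟨b, hb⟩ := rfl
      rw [this, map_add, hadd, add_mul]
      exact (norm_add_le _ _).trans (add_le_add (hC f t) (hC' f t))
    · rintro c a ha ⟨C, hC⟩
      refine ⟨‖c‖ * C, fun f t => ?_⟩
      have : (⟨c • a, Submodule.smul_mem _ c ha⟩ : sector (K := K) (1 : ℂ) (n + 1)) =
        c • ⟨a, ha⟩ := rfl
      rw [this, map_smul, hsmul, norm_mul, RCLike.norm_conj, mul_assoc]
      exact mul_le_mul_of_nonneg_left (hC f t) (norm_nonneg _)

/-- `e^{itφ(f)} Ω` tends weakly to zero on the finite particle vectors as `‖f‖ → ∞`. -/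
theorem tendsto_coherentCoeff {ι : Type*} {F : Filter ι} {f : ι → K}
    (hf : Tendsto (fun i => ‖f i‖) F atTop) {t : ℝ} (ht : t ≠ 0) (ψ : BosonFin K) :
    Tendsto (fun i => coherentCoeff (f i) t ψ) F (𝓝 0) := by
  induction ψ using bosonFin_induction with
  | h0 => simpa [coherentCoeff] using tendsto_const_nhds
  | hadd a b ha hb => simpa [coherentCoeff, inner_add_left] using ha.add hb
  | h n x =>
    obtain ⟨C, hC⟩ := exists_norm_coherentCoeff_le n x
    have h1 : Tendsto (fun i => |t| * ‖f i‖) F atTop := hf.const_mul_atTop (abs_pos.2 ht)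
    have h2 : Tendsto (fun y : ℝ => y ^ n * Real.exp (-(y ^ 2 / 4))) atTop (𝓝 0) := by
      refine squeeze_zero' (g := fun y : ℝ => y ^ n * Real.exp (-y)) ?_ ?_
        (Real.tendsto_pow_mul_exp_neg_atTop_nhds_zero n)
      · filter_upwards [eventually_ge_atTop 0] with y hy
        positivity
      -- From `y = 4` on, `y² / 4 ≥ y`.
      · filter_upwards [eventually_ge_atTop 4] with y hy
        gcongr
        nlinarith
    refine squeeze_zero_norm (fun i => hC (f i) t) ?_
    simpa using (h2.comp h1).const_mul C

end Coherent

/-! ### Linearity in the one-particle vector -/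

section Linearity

variable {K : Type u} [NormedAddCommGroup K] [InnerProductSpace ℂ K]

theorem insertion_add_left (ε : ℂ) (f g : K) (n : ℕ) (x : TPow K n) :
    insertion ε (f + g) n x = insertion ε f n x + insertion ε g n x := by
  induction n with
  | zero =>
    change consTensor K 0 ((f + g) ⊗ₜ x) = consTensor K 0 (f ⊗ₜ x) + consTensor K 0 (g ⊗ₜ x)
    rw [TensorProduct.add_tmul, map_add]
  | succ n ih =>
    obtain ⟨y, rfl⟩ := (consTensor K n).surjective x
    induction y using TensorProduct.induction_on with
    | zero => simp
    | tmul h z =>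
      simp only [insertion_consTensor, TensorProduct.add_tmul, ih, TensorProduct.tmul_add, map_add,
        smul_add]
      abel
    | add a b ha hb =>
      simp only [map_add, ha, hb]
      abel

theorem insertion_smul_left (ε : ℂ) (c : ℂ) (f : K) (n : ℕ) (x : TPow K n) :
    insertion ε (c • f) n x = c • insertion ε f n x := by
  induction n with
  | zero =>
    change consTensor K 0 ((c • f) ⊗ₜ x) = c • consTensor K 0 (f ⊗ₜ x)
    rw [← TensorProduct.smul_tmul', map_smul]
  | succ n ih =>
    obtain ⟨y, rfl⟩ := (consTensor K n).surjective x
    induction y using TensorProduct.induction_on with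
    | zero => simp
    | tmul h z =>
      simp only [insertion_consTensor, ← TensorProduct.smul_tmul', ih, TensorProduct.tmul_smul,
        map_smul, smul_add, smul_comm ε c]
    | add a b ha hb => simp only [map_add, ha, hb, smul_add]

theorem contract_add_left (f g : K) (n : ℕ) (x : TPow K (n + 1)) :
    contract (f + g) n x = contract f n x + contract g n x := by
  refine ext_inner_left ℂ fun y => ?_
  rw [inner_add_right, ← inner_consTensor_left, ← inner_consTensor_left, ← inner_consTensor_left,
    TensorProduct.add_tmul, map_add, inner_add_left]

/-- Only additivity in the one-particle vector is available over `ℂ`: the annihilation part is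
conjugate-linear and the creation part linear. -/
theorem segalField_add (f g : K) (ψ : BosonFin K) :
    segalField (f + g) ψ = segalField f ψ + segalField g ψ := by
  have h1 : bosonCreate (f + g) ψ = bosonCreate f ψ + bosonCreate g ψ := by
    induction ψ using bosonFin_induction with
    | h0 => simp
    | hadd a b ha hb => rw [map_add, ha, hb, map_add, map_add]; abel
    | h n x =>
      rw [bosonCreate_lof, bosonCreate_lof, bosonCreate_lof, ← map_add]
      congr 1
      apply Subtype.ext
      rw [Submodule.coe_add, coe_create, coe_create, coe_create, insertion_add_left, smul_add]
  have h2 : bosonAnnihilate (f + g) ψ = bosonAnnihilate f ψ + bosonAnnihilate g ψ := by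
    clear h1
    induction ψ using bosonFin_induction with
    | h0 => simp
    | hadd a b ha hb => rw [map_add, ha, hb, map_add, map_add]; abel
    | h n x =>
      rcases n with _ | n
      · simp only [bosonAnnihilate_lof_zero, add_zero]
      · rw [bosonAnnihilate_lof_succ, bosonAnnihilate_lof_succ, bosonAnnihilate_lof_succ,
          ← map_add]
        congr 1
        apply Subtype.ext
        rw [Submodule.coe_add, coe_annihilate, coe_annihilate, coe_annihilate, contract_add_left,
          smul_add]
  simp only [segalField_apply, h1, h2, smul_add]
  abel

/-- `f ↦ φ(f)ψ` as an additive map. -/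
def segalFieldHom (ψ : BosonFin K) : K →+ BosonFin K :=
  AddMonoidHom.mk' (fun f => segalField f ψ) fun f g => segalField_add f g ψ

theorem segalField_sum {ι : Type*} (s : Finset ι) (f : ι → K) (ψ : BosonFin K) :
    segalField (∑ i ∈ s, f i) ψ = ∑ i ∈ s, segalField (f i) ψ :=
  map_sum (segalFieldHom ψ) f s

end Linearity

/-! ### Occupation numbers -/

section Electrons

theorem finiteDimensional_tPow (K : Type u) [NormedAddCommGroup K] [InnerProductSpace ℂ K]
    [FiniteDimensional ℂ K] (n : ℕ) : FiniteDimensional ℂ (TPow K n) := by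
  induction n with
  | zero =>
    change FiniteDimensional ℂ (EuclideanSpace ℂ PUnit.{u + 1})
    infer_instance
  | succ n ih => exact (consTensor K n).toLinearEquiv.finiteDimensional

variable {Λ : Type v} [Fintype Λ]

instance finiteDimensional_electrons (N : ℕ) : FiniteDimensional ℂ (Electrons Λ N) :=
  have := finiteDimensional_tPow (OneElectron Λ) N
  FiniteDimensional.finiteDimensional_submodule _

variable [DecidableEq Λ]

theorem coe_occupation_succ (N : ℕ) (p : Λ × Fin 2) (u : Electrons Λ (N + 1)) :
    (occupation (N + 1) p u : TPow (OneElectron Λ) (N + 1)) =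
      insertion (-1) (orbital p) N (contract (orbital p) N u) := by
  change (create (-1) (orbital p) N (annihilate (-1) (orbital p) N u) :
    TPow (OneElectron Λ) (N + 1)) = _
  rw [coe_create, coe_annihilate, map_smul, smul_smul, inv_mul_cancel₀ (sqrt_succ_ne_zero N),
    one_smul]

theorem inner_occupation_left (N : ℕ) (p : Λ × Fin 2) (u v : Electrons Λ N) :
    ⟪occupation N p u, v⟫_ℂ = ⟪u, occupation N p v⟫_ℂ := by
  rcases N with _ | N
  · change ⟪(0 : Electrons Λ 0), v⟫_ℂ = ⟪u, (0 : Electrons Λ 0)⟫_ℂ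
    simp
  · change ⟪create (-1) _ N (annihilate (-1) _ N u), v⟫_ℂ =
      ⟪u, create (-1) _ N (annihilate (-1) _ N v)⟫_ℂ
    rw [inner_create_left (by norm_num) (by simp), ← inner_conj_symm u,
      inner_create_left (by norm_num) (by simp), inner_conj_symm]

/-- The commutator `[n_p, c*(f)] = ⟪p, f⟫ c*_p`. The sign from moving `c_p` past `c*(f)` cancels the
one from moving `c*_p` past it. -/
theorem occupation_sectorInsert (N : ℕ) (p : Λ × Fin 2) (f : OneElectron Λ)
    (u : Electrons Λ N) :
    occupation (N + 1) p (sectorInsert (-1) f N u) =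
      ⟪orbital p, f⟫_ℂ • sectorInsert (-1) (orbital p) N u +
        sectorInsert (-1) f N (occupation N p u) := by
  apply Subtype.ext
  rw [coe_occupation_succ]
  rcases N with _ | N
  · change insertion (-1) (orbital p) 0 (contract (orbital p) 0 (insertion (-1) f 0 u)) =
      ⟪orbital p, f⟫_ℂ • insertion (-1) (orbital p) 0 u + insertion (-1) f 0 0
    rw [contract_insertion_zero, map_smul, map_zero, add_zero]
  · rw [Submodule.coe_add, Submodule.coe_smul]
    change insertion (-1) (orbital p) (N + 1) (contract (orbital p) (N + 1)
      (insertion (-1) f (N + 1) u)) = ⟪orbital p, f⟫_ℂ • insertion (-1) (orbital p) (N + 1) u +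
        insertion (-1) f (N + 1) (occupation (N + 1) p u)
    rw [coe_occupation_succ, contract_insertion_succ, map_add, map_smul, map_smul,
      insertion_comm (by norm_num) (orbital p) f, smul_smul]
    norm_num

/-- `u` is a state in which exactly the orbitals in `A` are occupied. -/
def IsOccupied {N : ℕ} (A : Finset (Λ × Fin 2)) (u : Electrons Λ N) : Prop :=
  ∀ p, occupation N p u = (if p ∈ A then (1 : ℂ) else 0) • u

/-- Pauli's principle: `u = n_p u` already has the form of an insertion of `p`, and inserting `p`
twice gives zero by anticommutation. For `N = 0` the operator `n_p` is zero, so `u = 0`. -/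
theorem IsOccupied.sectorInsert_eq_zero {N : ℕ} {A : Finset (Λ × Fin 2)} {u : Electrons Λ N}
    (hu : IsOccupied A u) {p : Λ × Fin 2} (hp : p ∈ A) :
    sectorInsert (-1) (orbital p) N u = 0 := by
  have h := hu p
  rw [if_pos hp, one_smul] at h
  rw [← h]
  rcases N with _ | N
  · exact map_zero _
  · apply Subtype.ext
    change insertion (-1) (orbital p) (N + 1)
      (occupation (N + 1) p u : TPow (OneElectron Λ) (N + 1)) = 0
    rw [coe_occupation_succ]
    have h1 := insertion_comm (ε := -1) (by norm_num) (orbital p) (orbital p) N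
      (contract (orbital p) N u)
    rw [neg_one_smul] at h1
    rw [eq_neg_iff_add_eq_zero, ← two_smul ℂ] at h1
    exact (smul_eq_zero.1 h1).resolve_left two_ne_zero

theorem inner_orbital (p q : Λ × Fin 2) :
    ⟪orbital p, orbital q⟫_ℂ = if p = q then 1 else 0 := by
  simp [orbital, EuclideanSpace.inner_single_left]

theorem IsOccupied.sectorInsert {N : ℕ} {A : Finset (Λ × Fin 2)} {u : Electrons Λ N}
    (hu : IsOccupied A u) {p : Λ × Fin 2} (hp : p ∉ A) :
    IsOccupied (insert p A) (sectorInsert (-1) (orbital p) N u) := by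
  intro q
  rw [occupation_sectorInsert, hu q, map_smul, inner_orbital]
  by_cases h : q = p
  · subst h
    simp [hp]
  · simp [h]

/-- The sector is spanned by insertions, and the inserted vector can be expanded in orbitals.
Inserting an orbital into a state occupied on `A` either kills it or enlarges `A` by that orbital.
-/
theorem span_isOccupied (N : ℕ) :
    Submodule.span ℂ {u : Electrons Λ N | ∃ A, A.card = N ∧ IsOccupied A u} = ⊤ := by
  induction N with
  | zero =>
    rw [eq_top_iff]
    rintro u -
    exact Submodule.subset_span ⟨∅, rfl, fun p => by
      rw [if_neg (Finset.notMem_empty p), zero_smul]; rfl⟩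
  | succ N ih =>
    set M := Submodule.span ℂ {u : Electrons Λ (N + 1) | ∃ A, A.card = N + 1 ∧ IsOccupied A u}
    have horb : ∀ (p : Λ × Fin 2) (u : Electrons Λ N),
        sectorInsert (-1) (orbital p) N u ∈ M := by
      intro p u
      have h : Submodule.span ℂ {u : Electrons Λ N | ∃ A, A.card = N ∧ IsOccupied A u} ≤
          M.comap (sectorInsert (-1) (orbital p) N) := by
        rw [Submodule.span_le]
        rintro u ⟨A, hA, hu⟩
        rw [SetLike.mem_coe, Submodule.mem_comap]
        by_cases hp : p ∈ A
        · rw [hu.sectorInsert_eq_zero hp]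
          exact Submodule.zero_mem _
        · exact Submodule.subset_span
            ⟨insert p A, by rw [Finset.card_insert_of_notMem hp, hA], hu.sectorInsert hp⟩
      rw [ih] at h
      exact h Submodule.mem_top
    have hins : ∀ (f : OneElectron Λ) (u : Electrons Λ N), sectorInsert (-1) f N u ∈ M := by
      intro f u
      have hf : f ∈ Submodule.span ℂ (Set.range (EuclideanSpace.basisFun (Λ × Fin 2) ℂ)) := by
        have := (EuclideanSpace.basisFun (Λ × Fin 2) ℂ).toBasis.span_eq
        rw [OrthonormalBasis.coe_toBasis] at this
        rw [this]
        exact Submodule.mem_top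
      refine Submodule.span_induction (p := fun f _ => sectorInsert (-1) f N u ∈ M)
        ?_ ?_ ?_ ?_ hf
      · rintro _ ⟨p, rfl⟩
        rw [EuclideanSpace.basisFun_apply]
        exact horb p u
      · have : sectorInsert (-1) (0 : OneElectron Λ) N u = 0 := by
          apply Subtype.ext
          change insertion (-1) (0 : OneElectron Λ) N u = 0
          rw [← zero_smul ℂ (0 : OneElectron Λ), insertion_smul_left, zero_smul]
        rw [this]
        exact Submodule.zero_mem _
      · intro f g _ _ hf hg
        have : sectorInsert (-1) (f + g) N u =
            sectorInsert (-1) f N u + sectorInsert (-1) g N u :=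
          Subtype.ext (insertion_add_left _ _ _ _ _)
        rw [this]
        exact Submodule.add_mem _ hf hg
      · intro c f _ hf
        have : sectorInsert (-1) (c • f) N u = c • sectorInsert (-1) f N u :=
          Subtype.ext (insertion_smul_left _ _ _ _ _)
        rw [this]
        exact Submodule.smul_mem _ _ hf
    rw [eq_top_iff]
    rintro ⟨x, hx⟩ -
    refine Submodule.span_induction
      (p := fun x hx => (⟨x, hx⟩ : Electrons Λ (N + 1)) ∈ M) ?_ ?_ ?_ ?_ hx
    · rintro _ ⟨f, y, hy, rfl⟩
      exact hins f ⟨y, hy⟩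
    · exact Submodule.zero_mem _
    · intro a b ha hb hMa hMb
      exact Submodule.add_mem _ hMa hMb
    · intro c a ha hMa
      exact Submodule.smul_mem _ c hMa

theorem electrons_induction {N : ℕ} {P : Electrons Λ N → Prop} (h0 : P 0)
    (hadd : ∀ u v, P u → P v → P (u + v)) (hsmul : ∀ (c : ℂ) u, P u → P (c • u))
    (h : ∀ A u, A.card = N → IsOccupied A u → P u) (u : Electrons Λ N) : P u := by
  have hu : u ∈ Submodule.span ℂ {u : Electrons Λ N | ∃ A, A.card = N ∧ IsOccupied A u} := by
    rw [span_isOccupied]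
    exact Submodule.mem_top
  refine Submodule.span_induction (p := fun u _ => P u) ?_ h0 (fun u v _ _ => hadd u v)
    (fun c u _ => hsmul c u) hu
  rintro u ⟨A, hA, hu⟩
  exact h A u hA hu

end Electrons

/-! ### The coupling -/

section Coupling

/-- The tensor product of a finite-dimensional and a complete space is complete. -/
theorem completeSpace_innerTensor (E : Type u) (F : Type v) [NormedAddCommGroup E]
    [InnerProductSpace ℂ E] [FiniteDimensional ℂ E] [NormedAddCommGroup F]
    [InnerProductSpace ℂ F] [CompleteSpace F] : CompleteSpace (E ⊗[ℂ] F) := by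
  let b := stdOrthonormalBasis ℂ E
  -- The coordinate maps `⟪b i, ·⟫ ⊗ 1` into `F` are bounded and recover `x` as `∑ b i ⊗ c i x`, so
  -- a Cauchy sequence converges coordinate by coordinate.
  let c := fun i => (TensorProduct.lidIsometry ℂ F).toContinuousLinearEquiv.toContinuousLinearMap ∘L
    (innerSL ℂ (b i)).rTensor F
  have hc : ∀ x : E ⊗[ℂ] F, ∑ i, b i ⊗ₜ[ℂ] c i x = x := by
    intro x
    induction x using TensorProduct.induction_on with
    | zero => simp
    | tmul e f =>
      have : ∀ i, c i (e ⊗ₜ f) = ⟪b i, e⟫_ℂ • f := fun i => by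
        simp [c]
      simp only [this, ← TensorProduct.smul_tmul]
      rw [← TensorProduct.sum_tmul, b.sum_repr']
    | add x y hx hy =>
      simp only [map_add, TensorProduct.tmul_add, Finset.sum_add_distrib, hx, hy]
  refine Metric.complete_of_cauchySeq_tendsto fun x hx => ?_
  have h1 : ∀ i, ∃ y, Tendsto (fun n => c i (x n)) atTop (𝓝 y) := fun i =>
    cauchySeq_tendsto_of_complete (hx.map (c i).uniformContinuous)
  choose y hy using h1
  refine ⟨∑ i, b i ⊗ₜ[ℂ] y i, ?_⟩
  have h2 : Tendsto (fun n => ∑ i, b i ⊗ₜ[ℂ] c i (x n)) atTop (𝓝 (∑ i, b i ⊗ₜ[ℂ] y i)) :=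
    tendsto_finsetSum _ fun i _ => ((TensorProduct.mkL ℂ E F (b i)).continuous.tendsto _).comp (hy i)
  simpa only [hc] using h2

variable {K : Type u} [NormedAddCommGroup K] [InnerProductSpace ℂ K]
  {Λ : Type v} [Fintype Λ]

instance completeSpace_system (N : ℕ) : CompleteSpace (System K Λ N) :=
  completeSpace_innerTensor _ _

theorem systemEmbed_tmul (N : ℕ) (u : Electrons Λ N) (ψ : BosonFin K) :
    systemEmbed N (u ⊗ₜ[ℂ] ψ) = u ⊗ₜ[ℂ] bosonEmbed K ψ := rfl

theorem denseRange_systemEmbed (N : ℕ) :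
    DenseRange (systemEmbed (K := K) (Λ := Λ) N) := by
  intro x
  induction x using TensorProduct.induction_on with
  | zero => exact subset_closure ⟨0, map_zero _⟩
  | tmul e f =>
    refine map_mem_closure (TensorProduct.mkL ℂ (Electrons Λ N) (BosonFock K) e).continuous
      (denseRange_bosonEmbed f) ?_
    rintro _ ⟨ψ, rfl⟩
    exact ⟨e ⊗ₜ ψ, rfl⟩
  | add x y hx hy =>
    refine map_mem_closure₂ (f := fun x y : System K Λ N => x + y) continuous_add hx hy ?_
    rintro _ ⟨v, rfl⟩ _ ⟨w, rfl⟩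
    exact ⟨v + w, map_add _ _ _⟩

variable [DecidableEq Λ]

theorem inner_siteOccupation_left (N : ℕ) (x : Λ) (u v : Electrons Λ N) :
    ⟪siteOccupation N x u, v⟫_ℂ = ⟪u, siteOccupation N x v⟫_ℂ := by
  simp only [siteOccupation, LinearMap.add_apply, inner_add_left, inner_add_right,
    inner_occupation_left]

theorem couplingFin_tmul (N : ℕ) (g : Λ → K) (u : Electrons Λ N) (ψ : BosonFin K) :
    couplingFin N g (u ⊗ₜ[ℂ] ψ) = ∑ x, siteOccupation N x u ⊗ₜ[ℂ] segalField (g x) ψ := by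
  simp [couplingFin, LinearMap.sum_apply]

theorem inner_couplingFin_left (N : ℕ) (g : Λ → K) (w w' : Electrons Λ N ⊗[ℂ] BosonFin K) :
    ⟪systemEmbed N (couplingFin N g w), systemEmbed N w'⟫_ℂ =
      ⟪systemEmbed N w, systemEmbed N (couplingFin N g w')⟫_ℂ := by
  induction w using TensorProduct.induction_on with
  | zero => simp
  | add a b ha hb => simp only [map_add, inner_add_left, ha, hb]
  | tmul u ψ =>
    induction w' using TensorProduct.induction_on with
    | zero => simp
    | add a b ha hb => simp only [map_add, inner_add_right, ha, hb]
    | tmul v φ =>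
      simp only [couplingFin_tmul, map_sum, systemEmbed_tmul, sum_inner, inner_sum,
        TensorProduct.inner_tmul, inner_siteOccupation_left, inner_segalField_left]

/-- On `u` the operator `n_x` is the number of spins `s` with `(x, s) ∈ A`, so the sum over sites
becomes a sum over `A`, absorbed into one field by additivity. -/
theorem couplingFin_tmul_of_isOccupied {N : ℕ} (g : Λ → K) {A : Finset (Λ × Fin 2)}
    {u : Electrons Λ N} (hu : IsOccupied A u) (ψ : BosonFin K) :
    couplingFin N g (u ⊗ₜ[ℂ] ψ) = u ⊗ₜ[ℂ] segalField (∑ p ∈ A, g p.1) ψ := by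
  rw [couplingFin_tmul, segalField_sum, TensorProduct.tmul_sum,
    ← Finset.univ_inter A, ← Finset.sum_ite_mem, Fintype.sum_prod_type]
  refine Finset.sum_congr rfl fun x _ => ?_
  rw [Fin.sum_univ_two, siteOccupation, LinearMap.add_apply, hu, hu, TensorProduct.add_tmul]
  split_ifs <;> simp

theorem couplingFin_pow_tmul_of_isOccupied {N : ℕ} (g : Λ → K) {A : Finset (Λ × Fin 2)}
    {u : Electrons Λ N} (hu : IsOccupied A u) (ψ : BosonFin K) (n : ℕ) :
    (couplingFin N g ^ n) (u ⊗ₜ[ℂ] ψ) = u ⊗ₜ[ℂ] (segalField (∑ p ∈ A, g p.1) ^ n) ψ := by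
  induction n with
  | zero => rfl
  | succ n ih =>
    rw [pow_succ', Module.End.mul_apply, ih, couplingFin_tmul_of_isOccupied g hu, pow_succ',
      Module.End.mul_apply]

theorem isEntireVector_couplingFin (N : ℕ) (g : Λ → K) (w : Electrons Λ N ⊗[ℂ] BosonFin K) :
    IsEntireVector (systemEmbed N) (couplingFin N g) w := by
  induction w using TensorProduct.induction_on with
  | zero => exact isEntireVector_zero _ _
  | add a b ha hb => exact ha.add hb
  | tmul u ψ =>
    induction u using electrons_induction with
    | h0 => rw [TensorProduct.zero_tmul]; exact isEntireVector_zero _ _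
    | hadd u v hu hv => rw [TensorProduct.add_tmul]; exact hu.add hv
    | hsmul c u hu => rw [← TensorProduct.smul_tmul']; exact hu.smul c
    | h A u hA hu =>
      intro r hr
      refine ((isEntireVector_segalField (∑ p ∈ A, g p.1) ψ r hr).mul_left ‖u‖).congr fun n => ?_
      rw [couplingFin_pow_tmul_of_isOccupied g hu, systemEmbed_tmul, TensorProduct.norm_tmul]
      ring

theorem inner_expSeries_couplingFin {N : ℕ} (g : Λ → K) {A : Finset (Λ × Fin 2)}
    {u : Electrons Λ N} (hu : IsOccupied A u) (t : ℝ) (v : Electrons Λ N) (ψ : BosonFin K) :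
    ⟪systemEmbed N (v ⊗ₜ[ℂ] ψ),
      expSeries (systemEmbed N) (couplingFin N g) t (u ⊗ₜ[ℂ] vacuumFin K)⟫_ℂ =
      ⟪v, u⟫_ℂ * coherentCoeff (∑ p ∈ A, g p.1) t ψ := by
  have h1 := (innerSL ℂ (systemEmbed N (v ⊗ₜ[ℂ] ψ))).hasSum
    ((isEntireVector_couplingFin N g (u ⊗ₜ[ℂ] vacuumFin K)).hasSum t)
  have h2 := (hasSum_coherentCoeff (∑ p ∈ A, g p.1) t ψ).mul_left ⟪v, u⟫_ℂ
  refine h1.unique (h2.congr_fun fun n => ?_)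
  rw [innerSL_apply_apply, inner_smul_right, couplingFin_pow_tmul_of_isOccupied g hu,
    systemEmbed_tmul, systemEmbed_tmul, TensorProduct.inner_tmul]
  ring

theorem dressing_tmul_vacuum (N : ℕ) (ω : K →ₗ.[ℂ] K) (α : ℝ) (l : Λ → K) (u : Electrons Λ N) :
    dressing N ω α l (u ⊗ₜ[ℂ] vacuum K) =
      expSeries (systemEmbed N)
        (couplingFin N fun x => Complex.I • pmapApply ω.inverse (l x)) α
        (u ⊗ₜ[ℂ] vacuumFin K) :=
  expI_closedGraph (denseRange_systemEmbed N) (inner_couplingFin_left N _)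
    (isEntireVector_couplingFin N _) α (u ⊗ₜ[ℂ] vacuumFin K)

end Coupling

/-! ### The infrared singularity -/

section Infrared

theorem pmapApply_of_mem {E : Type*} [NormedAddCommGroup E] [InnerProductSpace ℂ E]
    {A : E →ₗ.[ℂ] E} {v : E} (h : v ∈ A.domain) : pmapApply A v = A ⟨v, h⟩ := by
  rw [pmapApply, dif_pos h]

theorem sum_pmapApply {E ι : Type*} [NormedAddCommGroup E] [InnerProductSpace ℂ E]
    (A : E →ₗ.[ℂ] E) (s : Finset ι) (v : ι → E) (h : ∀ i, v i ∈ A.domain) :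
    ∑ i ∈ s, pmapApply A (v i) = pmapApply A (∑ i ∈ s, v i) := by
  rw [pmapApply_of_mem (Submodule.sum_mem _ fun i _ => h i)]
  have : (⟨∑ i ∈ s, v i, Submodule.sum_mem _ fun i _ => h i⟩ : A.domain) =
      ∑ i ∈ s, ⟨v i, h i⟩ := by
    apply Subtype.ext
    simp
  rw [this, ← LinearPMap.toFun_eq_coe, map_sum]
  exact Finset.sum_congr rfl fun i _ => pmapApply_of_mem (h i)

variable {K : Type u} [NormedAddCommGroup K] [InnerProductSpace ℂ K] [CompleteSpace K]
  {ω : K →ₗ.[ℂ] K}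

/-- If `v ↦ ⟪w, v⟫` is bounded with respect to `v ↦ ‖ωv‖`, then `w` is in the range of `ω`. -/
theorem mem_range_of_inner_le (hω : IsSelfAdjoint ω) {w : K} {C : ℝ}
    (h : ∀ x : ω.domain, ‖⟪w, (x : K)⟫_ℂ‖ ≤ C * ‖ω x‖) : ∃ x : ω.domain, ω x = w := by
  have hker : ∀ x : ω.domain, ω x = 0 → ⟪w, (x : K)⟫_ℂ = 0 := fun x hx => by
    have := h x
    rw [hx, norm_zero, mul_zero] at this
    exact norm_le_zero_iff.1 this
  let f : ω.domain →ₗ[ℂ] ℂ := (innerₛₗ ℂ w) ∘ₗ ω.domain.subtype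
  have hf : LinearMap.ker ω.toFun ≤ LinearMap.ker f := fun x hx => hker x hx
  -- The functional `ω x ↦ ⟪w, x⟫` is well defined by `hker` and bounded by `C`. Hahn–Banach and
  -- Riesz represent it by a vector `u` with `⟪w, x⟫ = ⟪u, ω x⟫`, which says that `u` lies in the
  -- domain of the adjoint, which is `ω`, and is mapped to `w`.
  let g : LinearMap.range ω.toFun →ₗ[ℂ] ℂ :=
    (LinearMap.ker ω.toFun).liftQ f hf ∘ₗ ω.toFun.quotKerEquivRange.symm.toLinearMap
  have hg : ∀ x : ω.domain, g ⟨ω x, x, rfl⟩ = ⟪w, (x : K)⟫_ℂ := by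
    intro x
    have : ω.toFun.quotKerEquivRange.symm ⟨ω x, x, rfl⟩ = Submodule.Quotient.mk x := by
      rw [LinearEquiv.symm_apply_eq]
      rfl
    change (LinearMap.ker ω.toFun).liftQ f hf (ω.toFun.quotKerEquivRange.symm _) = _
    rw [this]
    rfl
  let G : StrongDual ℂ (LinearMap.range ω.toFun) := g.mkContinuous C (by
    rintro ⟨_, x, rfl⟩
    exact (congrArg norm (hg x)).trans_le (h x))
  obtain ⟨L, hL, -⟩ := exists_extension_norm_eq _ G
  obtain ⟨u, rfl⟩ := (InnerProductSpace.toDual ℂ K).surjective L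
  have hu : ∀ x : ω.domain, ⟪w, (x : K)⟫_ℂ = ⟪u, ω x⟫_ℂ := by
    intro x
    rw [← hg x]
    exact (hL ⟨ω x, x, rfl⟩).symm
  have hmem : u ∈ ω.adjoint.domain := LinearPMap.mem_adjoint_domain_of_exists _ ⟨w, hu⟩
  have happ := LinearPMap.adjoint_apply_eq hω.dense_domain ⟨u, hmem⟩ hu
  have key : ∃ x : ω.adjoint.domain, ω.adjoint x = w := ⟨_, happ⟩
  rw [LinearPMap.isSelfAdjoint_def.1 hω] at key
  exact key

/-- `‖ω⁻¹ vᵢ‖ → ∞` when `vᵢ` converges to a vector outside of `dom ω⁻¹`. -/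
theorem tendsto_norm_inverse_atTop (hω : IsSelfAdjoint ω) (hω' : HasNoEigenvalue ω) {ι : Type*}
    {F : Filter ι} {v : ι → K} {w : K} (hv : ∀ᶠ i in F, v i ∈ ω.inverse.domain)
    (hlim : Tendsto v F (𝓝 w)) (hw : w ∉ ω.inverse.domain) :
    Tendsto (fun i => ‖pmapApply ω.inverse (v i)‖) F atTop := by
  -- Zero is not an eigenvalue, so `ω` is injective and `ω.inverse` really sends `ω y` to `y`.
  have hker : LinearMap.ker ω.toFun = ⊥ := by
    rw [LinearMap.ker_eq_bot']
    intro x hx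
    exact Subtype.ext (hω' 0 x (by rw [zero_smul]; exact hx))
  rw [tendsto_atTop]
  by_contra! hC
  obtain ⟨C, hC⟩ := hC
  have hne := frequently_iff_neBot.1 (hC.and_eventually hv)
  -- If the norms do not diverge, they stay below some `C` along a finer nontrivial filter. There `v
  -- i = ω y` with `‖y‖ < C`, so `|⟪v i, x⟫| = |⟪y, ω x⟫| ≤ C ‖ω x‖`, and the bound passes to the
  -- limit `w`.
  set G := F ⊓ 𝓟 {i | ‖pmapApply ω.inverse (v i)‖ < C ∧ v i ∈ ω.inverse.domain}
  refine hw ?_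
  rw [LinearPMap.inverse_domain]
  refine mem_range_of_inner_le hω (C := C) fun x => ?_
  have h1 : Tendsto (fun i => ‖⟪v i, (x : K)⟫_ℂ‖) G (𝓝 ‖⟪w, (x : K)⟫_ℂ‖) :=
    ((hlim.mono_left inf_le_left).inner tendsto_const_nhds).norm
  refine le_of_tendsto h1 ?_
  have h2 : ∀ᶠ i in G, ‖pmapApply ω.inverse (v i)‖ < C ∧ v i ∈ ω.inverse.domain :=
    mem_inf_of_right (mem_principal_self _)
  filter_upwards [h2] with i hi
  obtain ⟨hi, hmem⟩ := hi
  have hrange := hmem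
  rw [LinearPMap.inverse_domain] at hrange
  obtain ⟨y, hy⟩ := hrange
  have hy' : pmapApply ω.inverse (v i) = y := by
    rw [pmapApply_of_mem hmem]
    exact LinearPMap.inverse_apply_eq hker hy
  rw [hy'] at hi
  have hsymm : ⟪ω y, (x : K)⟫_ℂ = ⟪(y : K), ω x⟫_ℂ := by
    have h3 := LinearPMap.adjoint_isFormalAdjoint (T := ω) hω.dense_domain
    rw [LinearPMap.isSelfAdjoint_def.1 hω] at h3
    exact h3 y x
  rw [show v i = ω y from hy.symm, hsymm]
  exact (norm_inner_le_norm _ _).trans (mul_le_mul_of_nonneg_right hi.le (norm_nonneg _))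

end Infrared

/-! ### Weak convergence -/

section WeakConvergence

variable {H : Type*} [NormedAddCommGroup H] [InnerProductSpace ℂ H] {ι : Type*} {F : Filter ι}

theorem tendsto_inner_zero_of_dense {s : Set H} (hs : Dense s) {v : ι → H} {C : ℝ}
    (hv : ∀ i, ‖v i‖ ≤ C) (h : ∀ x ∈ s, Tendsto (fun i => ⟪x, v i⟫_ℂ) F (𝓝 0)) (x : H) :
    Tendsto (fun i => ⟪x, v i⟫_ℂ) F (𝓝 0) := by
  rw [Metric.tendsto_nhds]
  intro ε hε
  obtain ⟨y, hy, hxy⟩ := hs.exists_dist_lt x (show 0 < ε / 2 / (|C| + 1) by positivity)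
  filter_upwards [Metric.tendsto_nhds.1 (h y hy) (ε / 2) (by positivity)] with i hi
  rw [dist_zero_right] at hi ⊢
  have h1 : ⟪x, v i⟫_ℂ = ⟪x - y, v i⟫_ℂ + ⟪y, v i⟫_ℂ := by rw [inner_sub_left]; ring
  have h2 : ‖⟪x - y, v i⟫_ℂ‖ ≤ ε / 2 := by
    refine (norm_inner_le_norm _ _).trans ?_
    rw [dist_eq_norm, lt_div_iff₀ (by positivity)] at hxy
    have : ‖v i‖ ≤ |C| + 1 := (hv i).trans ((le_abs_self C).trans (by linarith))
    nlinarith [norm_nonneg (x - y), norm_nonneg (v i)]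
  rw [h1]
  linarith [norm_add_le ⟪x - y, v i⟫_ℂ ⟪y, v i⟫_ℂ]

/-- A pointwise null family of linear functionals on a finite-dimensional space is null along
bounded families. -/
theorem tendsto_apply_zero_of_bounded {E : Type*} [NormedAddCommGroup E] [InnerProductSpace ℂ E]
    [FiniteDimensional ℂ E] {L : ι → E →ₗ[ℂ] ℂ} (hL : ∀ u, Tendsto (fun i => L i u) F (𝓝 0))
    {u : ι → E} {C : ℝ} (hu : ∀ᶠ i in F, ‖u i‖ ≤ C) : Tendsto (fun i => L i (u i)) F (𝓝 0) := by
  let b := stdOrthonormalBasis ℂ E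
  have h1 : ∀ i, L i (u i) = ∑ k, ⟪b k, u i⟫_ℂ * L i (b k) := fun i => by
    conv_lhs => rw [← b.sum_repr' (u i)]
    simp
  simp only [h1]
  rw [← Finset.sum_const_zero (s := Finset.univ) (ι := Fin (Module.finrank ℂ E))]
  refine tendsto_finsetSum _ fun k _ => ?_
  have h2 : Tendsto (fun i => C * ‖L i (b k)‖) F (𝓝 0) := by
    simpa using ((hL (b k)).norm).const_mul C
  refine squeeze_zero_norm' ?_ h2
  filter_upwards [hu] with i hi
  rw [norm_mul]
  refine mul_le_mul_of_nonneg_right ((norm_inner_le_norm _ _).trans ?_) (norm_nonneg _)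
  rw [b.norm_eq_one, one_mul]
  exact hi

variable {K : Type u} [NormedAddCommGroup K] [InnerProductSpace ℂ K]
  {Λ : Type v} [Fintype Λ] [DecidableEq Λ]

/-- The dressed states over a state with occupied orbitals `A` tend weakly to zero when
`‖∑_{(x,s) ∈ A} ω⁻¹ l_x‖ → ∞`. -/
theorem tendsto_inner_dressing_of_isOccupied {N : ℕ} {ω : K →ₗ.[ℂ] K} {α : ℝ} (hα : α ≠ 0)
    {l : ι → Λ → K} {A : Finset (Λ × Fin 2)} {u : Electrons Λ N} (hu : IsOccupied A u)
    (h : Tendsto (fun i => ‖∑ p ∈ A, pmapApply ω.inverse (l i p.1)‖) F atTop)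
    (Φ : System K Λ N) :
    Tendsto (fun i => ⟪Φ, dressing N ω α (l i) (u ⊗ₜ[ℂ] vacuum K)⟫_ℂ) F (𝓝 0) := by
  refine tendsto_inner_zero_of_dense (denseRange_systemEmbed N)
    (C := ‖(u ⊗ₜ[ℂ] vacuum K : System K Λ N)‖)
    (fun i => (LinearIsometryEquiv.norm_map _ _).le) ?_ Φ
  rintro _ ⟨w, rfl⟩
  simp only [dressing_tmul_vacuum]
  induction w using TensorProduct.induction_on with
  | zero => simpa using tendsto_const_nhds
  | add a b ha hb => simpa only [map_add, inner_add_left, add_zero] using ha.add hb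
  | tmul v ψ =>
    simp only [inner_expSeries_couplingFin _ hu]
    have h1 : Tendsto (fun i => ‖∑ p ∈ A, Complex.I • pmapApply ω.inverse (l i p.1)‖) F atTop := by
      simpa only [← Finset.smul_sum, norm_smul, Complex.norm_I, one_mul] using h
    simpa using (tendsto_coherentCoeff h1 hα ψ).const_mul ⟪v, u⟫_ℂ

end WeakConvergence

end HubbardPhonon

end

open HubbardPhonon in
theorem mainTheorem4
    {Λ : Type*} [Fintype Λ] [DecidableEq Λ]
    {K : Type*} [NormedAddCommGroup K] [InnerProductSpace ℂ K] [CompleteSpace K]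
    [TopologicalSpace.SeparableSpace K]
    (N : ℕ) (hN : 1 ≤ N)
    (T : Matrix (Λ × Fin 2) (Λ × Fin 2) ℂ) (hT : T.IsHermitian)
    (U : ℝ) (hU : 0 < U) (α : ℝ) (hα : α ≠ 0)
    (ω : K →ₗ.[ℂ] K) (hω : IsNonnegSelfAdjoint ω) (hω' : HasNoEigenvalue ω)
    (l : Λ → K) (hl : IsRealCoupling ω l)
    (hsing : ∀ A : Finset (Λ × Fin 2), A.card = N → ∑ p ∈ A, l p.1 ∉ ω.inverse.domain)
    (lκ : ℝ → Λ → K) (hlκ : ∀ κ > 0, IsRealCoupling ω (lκ κ))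
    (hreg : ∀ κ > 0, ∀ x, lκ κ x ∈ ω.inverse.domain)
    (hconv : ∀ x, Tendsto (fun κ => lκ κ x) (𝓝[>] 0) (𝓝 (l x)))
    (hconv' : ∀ x, Tendsto (fun κ => pmapApply (invSqrt ω) (lκ κ x)) (𝓝[>] 0)
      (𝓝 (pmapApply (invSqrt ω) (l x))))
    (b : ℝ → ℝ)
    (hb : ∀ κ > 0, ∀ x y, ⟪pmapApply (invSqrt ω) (lκ κ x), pmapApply (invSqrt ω) (lκ κ y)⟫_ℂ =
      if x = y then ((b κ ^ 2 : ℝ) : ℂ) else 0)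
    (Ψe : ℝ → Electrons Λ N)
    (hΨe : ∀ κ > 0, IsGroundState (hubbard N T (U - (α * b κ) ^ 2)) (Ψe κ)) :
    ∀ Φ : System K Λ N,
      Tendsto (fun κ => ⟪Φ, dressing N ω α (lκ κ) (Ψe κ ⊗ₜ[ℂ] vacuum K)⟫_ℂ) (𝓝[>] 0) (𝓝 0) := by
  intro Φ
  -- The electron vector varies with `κ`, so the matrix element is treated as a functional of it, to
  -- be shown null at each fixed vector.
  let L : ℝ → Electrons Λ N →ₗ[ℂ] ℂ := fun κ =>
    innerₛₗ ℂ Φ ∘ₗ (dressing N ω α (lκ κ)).toLinearEquiv.toLinearMap ∘ₗ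
      (TensorProduct.mk ℂ (Electrons Λ N) (BosonFock K)).flip (vacuum K)
  have hL : ∀ u, Tendsto (fun κ => L κ u) (𝓝[>] 0) (𝓝 0) := by
    intro u
    induction u using electrons_induction with
    | h0 => simpa only [map_zero] using tendsto_const_nhds
    | hadd u v hu hv => simpa only [map_add, add_zero] using hu.add hv
    | hsmul c u hu => simpa only [map_smul, smul_zero] using hu.const_smul c
    | h A u hA hu =>
      refine tendsto_inner_dressing_of_isOccupied hα hu ?_ Φ
      have hpos : ∀ᶠ κ : ℝ in 𝓝[>] 0, 0 < κ := self_mem_nhdsWithin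
      have h1 := tendsto_norm_inverse_atTop hω.1 hω' (F := 𝓝[>] (0 : ℝ))
        (v := fun κ => ∑ p ∈ A, lκ κ p.1) (w := ∑ p ∈ A, l p.1)
        (hpos.mono fun κ hκ => Submodule.sum_mem _ fun p _ => hreg κ hκ p.1)
        (tendsto_finsetSum _ fun p _ => hconv p.1) (hsing A hA)
      refine h1.congr' (hpos.mono fun κ hκ => ?_)
      dsimp only
      rw [sum_pmapApply _ _ _ fun p : Λ × Fin 2 => hreg κ hκ p.1]
  -- Normalisation bounds the ground states by `1` uniformly in `κ`.
  refine tendsto_apply_zero_of_bounded hL (u := Ψe) (C := 1) ?_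
  filter_upwards [self_mem_nhdsWithin] with κ hκ
  exact (hΨe κ hκ).1.le
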